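/- Let $R$ be a commutative local domain of Krull dimension $1$ (not necessarily noetherian), with field of fractions $Q$. For a commutative ring $A$ and an $A$-module $M$, let $\mathrm{Add}(M)$ be the class of $A$-modules isomorphic to direct summands of direct sums of (arbitrarily many) copies of $M$, and let $A^{(\omega)}$ be the free $A$-module of countably infinite rank. An indecomposable module is understood to be non-zero, and direct sums may have infinitely many summands. For a domain $A$ consider the following conditions. (i) The class of direct sums of finitely generated torsion-free $A$-modules is closed under direct summands. (ii) For every finitely generated torsion-free $A$-module $M$, every direct summand of $A^{(\omega)}\oplus M$ is a direct sum of finitely generated modules. (iii) For every finitely generated torsion-free $A$-module $M$, every module in $\mathrm{Add}(M)$ is a direct sum of finitely generated modules. (iv) Every finitely generated indecomposable torsion-free $A$-module has local endomorphism ring. Then for $A=R$ the conditions (i), (ii), (iii) and (iv) are equivalent. Moreover, if they hold for $A=R$, then all of (i)–(iv) hold for $A=S$, for every ring $S$ with $R\subseteq S\subseteq \overline{R}$, where $\overline{R}$ is the integral closure of $R$ in $Q$. -/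

import Mathlib

universe u w

/-- `N` is isomorphic to a direct summand of `M`. -/
def IsSummandOf (R : Type*) [CommRing R] (N M : Type*) [AddCommGroup N] [Module R N]
    [AddCommGroup M] [Module R M] : Prop :=
  ∃ K : Submodule R M, IsComplemented K ∧ Nonempty (N ≃ₗ[R] K)

/-- `N` is the (internal, possibly infinite) direct sum of finitely generated submodules. -/
def IsDirectSumOfFG (R : Type*) [CommRing R] (N : Type w) [AddCommGroup N] [Module R N] : Prop :=
  ∃ (ι : Type w) (_ : DecidableEq ι) (A : ι → Submodule R N),
    DirectSum.IsInternal A ∧ ∀ i, Module.Finite R (A i)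

/-- `N` is the (internal, possibly infinite) direct sum of finitely generated torsion-free
submodules. -/
def IsDirectSumOfFGTorsionFree (R : Type*) [CommRing R] (N : Type w) [AddCommGroup N]
    [Module R N] : Prop :=
  ∃ (ι : Type w) (_ : DecidableEq ι) (A : ι → Submodule R N),
    DirectSum.IsInternal A ∧ ∀ i, Module.Finite R (A i) ∧ Module.IsTorsionFree R (A i)

/-- `N` belongs to `Add(M)`: it is isomorphic to a direct summand of a direct sum of copies
of `M`. -/
def MemAdd (R : Type*) [CommRing R] (M N : Type w) [AddCommGroup M] [Module R M]
    [AddCommGroup N] [Module R N] : Prop :=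
  ∃ ι : Type w, IsSummandOf R N (ι →₀ M)

/-- `M` is non-zero and is not the internal direct sum of two non-zero submodules. -/
def IsIndecomposableModule (R : Type*) [CommRing R] (M : Type*) [AddCommGroup M]
    [Module R M] : Prop :=
  Nontrivial M ∧ ∀ K L : Submodule R M, IsCompl K L → K = ⊥ ∨ L = ⊥

/-- The class of direct sums of finitely generated torsion-free `R`-modules (in universe `w`) is
closed under direct summands. -/
def DirectSumsClosedUnderSummands (R : Type u) [CommRing R] : Prop :=
  ∀ (M N : Type w) [AddCommGroup M] [Module R M] [AddCommGroup N] [Module R N],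
    IsDirectSumOfFGTorsionFree R M → IsSummandOf R N M → IsDirectSumOfFGTorsionFree R N

/-- For every finitely generated torsion-free `M`, every direct summand of `R^(ω) ⊕ M` is a direct
sum of finitely generated modules. -/
def SummandsOfFreePlusAreDirectSums (R : Type u) [CommRing R] : Prop :=
  ∀ (M N : Type w) [AddCommGroup M] [Module R M] [AddCommGroup N] [Module R N],
    Module.Finite R M → Module.IsTorsionFree R M →
      IsSummandOf R N ((ℕ →₀ R) × M) → IsDirectSumOfFG R N

/-- For every finitely generated torsion-free `M`, every module in `Add(M)` is a direct sum of
finitely generated modules. -/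
def AddModulesAreDirectSums (R : Type u) [CommRing R] : Prop :=
  ∀ (M N : Type w) [AddCommGroup M] [Module R M] [AddCommGroup N] [Module R N],
    Module.Finite R M → Module.IsTorsionFree R M → MemAdd R M N → IsDirectSumOfFG R N

/-- Every finitely generated indecomposable torsion-free `R`-module has local endomorphism ring. -/
def IndecomposablesHaveLocalEnd (R : Type u) [CommRing R] : Prop :=
  ∀ (M : Type w) [AddCommGroup M] [Module R M],
    Module.Finite R M → Module.IsTorsionFree R M → IsIndecomposableModule R M →
      IsLocalRing (Module.End R M)

-- The cycle is (i) ⇒ (iii) ⇒ (ii) ⇒ (iv) ⇒ (i); only the last two implications have content.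
--
-- (iv) ⇒ (i) holds over every domain. By induction on rank, finitely generated torsion-free modules
-- are finite sums of indecomposables, whose endomorphism rings are local by (iv). Such finite sums
-- have the exchange property (`Finset.exists_exchange_of_isLocalRing`), so a finitely generated
-- submodule of a summand lies in a finitely generated summand of it
-- (`Submodule.FG.exists_fg_summand`). Kaplansky's dévissage reduces to countably generated
-- summands, from which finitely generated pieces are split off one by one.
--
-- (ii) ⇒ (iv) is where locality and dimension one enter. If `f` and `1 - f` are both non-units on
-- an indecomposable `M`, a polynomial in `f` gives `e` with `e² - e` divisible by a prescribed `r ≠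
-- 0`, and with `e` and `1 - e` nonzero modulo `𝔪` (`Module.End.exists_almost_idempotent`). Take `r`
-- with `rM` inside a finite free `F ⊆ M`: then `e` is idempotent up to maps through `F`. Such an
-- `e` splits after adding countably many copies of `F`: a telescope is a summand of `M ⊕ F^(ω)`
-- playing the role of `eM`. By (ii) the telescope and its complement are both finitely generated
-- plus projective, and indecomposability of `M` makes one of them projective. Since `M` has no
-- surjective linear form, maps from `M` through projectives vanish modulo `𝔪`; so `e` or `1 - e`
-- does, a contradiction.
--
-- For the rings between `R` and its integral closure, (iv) is what descends: an endomorphism of an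
-- `S`-module is already visible on a lattice finitely generated over `R`. The domain-level
-- implications then give the other conditions.

universe v

/-! ### Exchange property and decomposition into indecomposables. -/

section Exchange

open Submodule
open LinearMap (ker mem_ker)

variable {R : Type*} [CommRing R] {M : Type*} [AddCommGroup M] [Module R M]

lemma isCompl_sup_left_of_isCompl_sup_right {α : Type*} [Lattice α] [BoundedOrder α]
    [IsModularLattice α] {a c k : α} (h : IsCompl c (a ⊔ k)) (hd : Disjoint a k) :
    IsCompl (a ⊔ c) k := by
  refine ⟨?_, ?_⟩
  · rw [sup_comm a c]
    exact Disjoint.disjoint_sup_left_of_disjoint_sup_right hd h.disjoint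
  · rw [codisjoint_iff, sup_comm a c, sup_assoc]
    exact h.sup_eq_top

/-- If `p : M → C` composed with the projection onto `N` along `B` restricts to an automorphism of
`C`, then `C` replaces a complement of `N ⊓ ker p` in `N`. -/
lemma isCompl_sup_inf_ker_of_bijective {C N B : Submodule R M} (h : IsCompl N B) (p : M →ₗ[R] C)
    (hb : Function.Bijective ((p ∘ₗ N.projection B h) ∘ₗ C.subtype)) :
    IsCompl C (B ⊔ N ⊓ ker p) := by
  have hker : B ⊔ N ⊓ ker p = ker (p ∘ₗ N.projection B h) := by
    apply le_antisymm
    · refine sup_le (fun x hx => ?_) (fun x hx => ?_)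
      · have : N.projection B h x = 0 := (projection_apply_eq_zero_iff h).2 hx
        simp [this]
      · have : N.projection B h x = x := projection_eq_self_iff h x |>.2 hx.1
        simpa [this] using hx.2
    · intro x hx
      rw [Submodule.mem_sup]
      refine ⟨x - N.projection B h x, sub_projection_mem h x, N.projection B h x,
        ⟨projection_apply_mem h x, hx⟩, by simp⟩
  rw [hker]
  refine ⟨disjoint_def.2 fun x hx hx0 => ?_, codisjoint_iff.2 (eq_top_iff.2 fun x _ => ?_)⟩
  · have : (⟨x, hx⟩ : C) = 0 := hb.1 (by simpa using hx0)
    simpa using this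
  · obtain ⟨c, hc⟩ := hb.2 ((p ∘ₗ N.projection B h) x)
    rw [Submodule.mem_sup]
    refine ⟨c, c.2, x - c, ?_, by simp⟩
    rw [mem_ker, map_sub, sub_eq_zero]
    exact hc.symm

/-- The exchange step: a summand with local endomorphism ring is moved across a decomposition. -/
lemma exists_exchange_of_isLocalRing {A C L N₁ N₁' : Submodule R M} (hAC : Disjoint A C)
    (hL : IsCompl (A ⊔ C) L) (h : IsCompl A (N₁ ⊔ N₁')) (hd : Disjoint N₁ N₁')
    [IsLocalRing (Module.End R C)] :
    ∃ N₂ ≤ N₁, ∃ N₂' ≤ N₁', IsCompl (A ⊔ C) (N₂ ⊔ N₂') := by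
  have hC : IsCompl C (A ⊔ L) := by
    refine ⟨?_, ?_⟩
    · have h1 : Disjoint (C ⊔ A) L := by rw [sup_comm]; exact hL.disjoint
      exact hAC.symm.disjoint_sup_right_of_disjoint_sup_left h1
    · rw [codisjoint_iff, ← sup_assoc, sup_comm C A]; exact hL.sup_eq_top
  have h1 : IsCompl N₁ (A ⊔ N₁') := by
    refine ⟨?_, ?_⟩
    · have := h.disjoint
      rw [sup_comm A N₁']
      refine hd.disjoint_sup_right_of_disjoint_sup_left ?_
      exact this.symm
    · rw [codisjoint_iff, sup_left_comm]; exact h.sup_eq_top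
  have h2 : IsCompl N₁' (A ⊔ N₁) := by
    refine ⟨?_, ?_⟩
    · rw [sup_comm A N₁]
      refine hd.symm.disjoint_sup_right_of_disjoint_sup_left ?_
      rw [sup_comm]; exact h.disjoint.symm
    · rw [codisjoint_iff, sup_left_comm, sup_comm N₁']; exact h.sup_eq_top
  set p : M →ₗ[R] C := C.projectionOnto (A ⊔ L) hC with hp
  have hpA : ∀ x ∈ A, p x = 0 := fun x hx =>
    (projectionOnto_apply_eq_zero_iff hC).2 (le_sup_left (a := A) hx)
  set f : Module.End R C := (p ∘ₗ N₁.projection _ h1) ∘ₗ C.subtype with hf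
  set g : Module.End R C := (p ∘ₗ N₁'.projection _ h2) ∘ₗ C.subtype with hg
  -- The identity of `C` is the sum of its two routes, through `N₁` and through `N₁'`; the
  -- `A`-component is killed by `p`. Locality makes one route an automorphism.
  have hfg : f + g = 1 := by
    ext1 x
    obtain ⟨a, ha, y, hy, hxy⟩ := Submodule.mem_sup.1
      (h.sup_eq_top ▸ mem_top : (x : M) ∈ A ⊔ (N₁ ⊔ N₁'))
    obtain ⟨n, hn, n', hn', rfl⟩ := Submodule.mem_sup.1 hy
    have e1 : N₁.projection _ h1 x = n := by
      rw [← hxy, show a + (n + n') = n + (a + n') by abel, map_add,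
        (projection_eq_self_iff h1 n).2 hn, (projection_apply_eq_zero_iff h1).2
          (add_mem (le_sup_left (a := A) ha) (le_sup_right (a := A) hn')), add_zero]
    have e2 : N₁'.projection _ h2 x = n' := by
      rw [← hxy, show a + (n + n') = n' + (a + n) by abel, map_add,
        (projection_eq_self_iff h2 n').2 hn', (projection_apply_eq_zero_iff h2).2
          (add_mem (le_sup_left (a := A) ha) (le_sup_right (a := A) hn)), add_zero]
    have e3 : p x = x := projectionOnto_apply_left hC x
    rw [← hxy, map_add, hpA a ha, zero_add, map_add] at e3
    simp only [hf, hg, LinearMap.add_apply, LinearMap.comp_apply, subtype_apply, e1, e2, e3]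
    rfl
  have key : ∀ {P Q : Submodule R M} (hPQ : IsCompl P (A ⊔ Q)), Disjoint A (Q ⊔ P) →
      Function.Bijective ((p ∘ₗ P.projection _ hPQ) ∘ₗ C.subtype) →
      IsCompl (A ⊔ C) (Q ⊔ P ⊓ ker p) := by
    intro P Q hPQ hd hb
    have := isCompl_sup_inf_ker_of_bijective hPQ p hb
    rw [sup_assoc] at this
    exact isCompl_sup_left_of_isCompl_sup_right this (hd.mono_right (sup_le_sup_left inf_le_left _))
  rcases IsLocalRing.isUnit_or_isUnit_of_add_one hfg with hu | hu
  · refine ⟨N₁ ⊓ ker p, inf_le_left, N₁', le_rfl, ?_⟩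
    rw [sup_comm (N₁ ⊓ _)]
    exact key h1 (by rw [sup_comm]; exact h.disjoint) ((Module.End.isUnit_iff _).1 hu)
  · refine ⟨N₁, le_rfl, N₁' ⊓ ker p, inf_le_left, ?_⟩
    exact key h2 h.disjoint ((Module.End.isUnit_iff _).1 hu)

/-- A finite direct sum of modules with local endomorphism rings has the exchange property for
decompositions into two summands. -/
lemma Finset.exists_exchange_of_isLocalRing (t : Finset (Submodule R M))
    (ht : t.SupIndep id) (hloc : ∀ T ∈ t, IsLocalRing (Module.End R T))
    (hc : IsComplemented (t.sup id)) {N N' : Submodule R M} (h : IsCompl N N') :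
    ∃ N₁ ≤ N, ∃ N₁' ≤ N', IsCompl (t.sup id) (N₁ ⊔ N₁') := by
  classical
  induction t using Finset.induction_on with
  | empty => exact ⟨N, le_rfl, N', le_rfl, by simpa [h.sup_eq_top] using isCompl_bot_top⟩
  | insert C t hC ih =>
    have hd : Disjoint (t.sup id) C :=
      (ht (Finset.subset_insert C t) (Finset.mem_insert_self C t) hC).symm
    rw [Finset.sup_insert, id, sup_comm] at hc ⊢
    obtain ⟨L, hL⟩ := hc
    obtain ⟨N₁, h1, N₁', h1', hN⟩ := ih (ht.subset (Finset.subset_insert C t))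
      (fun T hT => hloc T (Finset.mem_insert_of_mem hT))
      ⟨C ⊔ L, hd.disjoint_sup_right_of_disjoint_sup_left hL.disjoint,
        by rw [codisjoint_iff, ← sup_assoc]; exact hL.sup_eq_top⟩
    have := hloc C (Finset.mem_insert_self C t)
    obtain ⟨N₂, h2, N₂', h2', hN2⟩ := _root_.exists_exchange_of_isLocalRing hd hL hN
      (h.disjoint.mono h1 h1')
    exact ⟨N₂, h2.trans h1, N₂', h2'.trans h1', hN2⟩

lemma Submodule.FG.of_sup_of_disjoint {A B : Submodule R M} (h : (A ⊔ B).FG)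
    (hd : Disjoint A B) : A.FG := by
  refine fg_of_fg_map_of_fg_inf_ker B.mkQ ?_ ?_
  · have := h.map B.mkQ
    rwa [Submodule.map_sup, Submodule.mkQ_map_self, sup_bot_eq] at this
  · rw [ker_mkQ, hd.eq_bot]
    exact fg_bot

/-- A finitely generated torsion-free submodule over a domain is a finite direct sum of
indecomposable ones. -/
lemma Submodule.exists_finset_indecomposable_of_fg [IsDomain R] (K : Submodule R M)
    [Module.IsTorsionFree R K] (hK : K.FG) :
    ∃ t : Finset (Submodule R M), t.SupIndep id ∧ t.sup id = K ∧
      ∀ T ∈ t, T.FG ∧ T ≠ ⊥ ∧ ∀ A B, Disjoint A B → A ⊔ B = T → A = ⊥ ∨ B = ⊥ := by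
  classical
  induction hn : Module.finrank R K using Nat.strong_induction_on generalizing K with
  | _ n ih =>
  by_cases h0 : K = ⊥
  · exact ⟨∅, by simp, by simp [h0], by simp⟩
  by_cases hi : ∀ A B, Disjoint A B → A ⊔ B = K → A = ⊥ ∨ B = ⊥
  · exact ⟨{K}, by simp, by simp, by simpa using ⟨hK, h0, hi⟩⟩
  push Not at hi
  obtain ⟨A, B, hd, rfl, hA, hB⟩ := hi
  have hAf := hK.of_sup_of_disjoint hd
  have hBf := (sup_comm A B ▸ hK).of_sup_of_disjoint hd.symm
  have : Module.Finite R A := Module.Finite.of_fg hAf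
  have : Module.Finite R B := Module.Finite.of_fg hBf
  have tA : Module.IsTorsionFree R A :=
    (inclusion_injective le_sup_left).moduleIsTorsionFree (inclusion (le_sup_left (b := B)))
      (by simp)
  have tB : Module.IsTorsionFree R B :=
    (inclusion_injective le_sup_right).moduleIsTorsionFree (inclusion (le_sup_right (a := A)))
      (by simp)
  have nA : Nontrivial A := nontrivial_iff_ne_bot.2 hA
  have nB : Nontrivial B := nontrivial_iff_ne_bot.2 hB
  have hr : Module.finrank R ↥(A ⊔ B) = Module.finrank R A + Module.finrank R B := by
    have := Submodule.rank_sup_add_rank_inf_eq A B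
    have fAB : Module.Finite R ↥(A ⊔ B) := Module.Finite.of_fg hK
    rw [hd.eq_bot, rank_bot, add_zero, ← Module.finrank_eq_rank, ← Module.finrank_eq_rank,
      ← Module.finrank_eq_rank] at this
    exact_mod_cast this
  -- Nonzero finitely generated torsion-free modules have positive rank, so both pieces have smaller
  -- rank than their sum.
  have pA : 0 < Module.finrank R A := Module.finrank_pos
  have pB : 0 < Module.finrank R B := Module.finrank_pos
  obtain ⟨s, hs, rfl, hs'⟩ := ih _ (by omega) A hAf rfl
  obtain ⟨t, ht, rfl, ht'⟩ := ih _ (by omega) B hBf rfl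
  refine ⟨s ∪ t, ?_, Finset.sup_union, fun T hT => (Finset.mem_union.1 hT).elim (hs' T) (ht' T)⟩
  have hne : ∀ T ∈ s, T ∉ t := fun T h1 h2 => (hs' T h1).2.1 <| by
    simpa using hd.mono (Finset.le_sup (f := id) h1) (Finset.le_sup (f := id) h2)
  exact hs.union ht hd

end Exchange

/-! ### Kaplansky's dévissage for summands of direct sums. -/

section Kaplansky

open Submodule
open LinearMap (ker mem_ker)

variable {R : Type*} [CommRing R] {M : Type*} [AddCommGroup M] [Module R M]

lemma Submodule.FG.exists_finset_le_biSup {ι : Type*} {A : ι → Submodule R M}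
    {G : Submodule R M} (hG : G.FG) (h : G ≤ ⨆ i, A i) :
    ∃ s : Finset ι, G ≤ ⨆ i ∈ s, A i :=
  CompleteLattice.IsCompactElement.exists_finset_of_le_iSup _ ((Submodule.fg_iff_compact G).1 hG) A h

lemma isIndecomposableModule_of_disjoint_sup {T : Submodule R M} (h0 : T ≠ ⊥)
    (h : ∀ A B, Disjoint A B → A ⊔ B = T → A = ⊥ ∨ B = ⊥) : IsIndecomposableModule R T := by
  refine ⟨nontrivial_iff_ne_bot.2 h0, fun K L hKL => ?_⟩
  have := h (K.map T.subtype) (L.map T.subtype)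
    (by rw [disjoint_iff, ← Submodule.map_inf _ T.injective_subtype, hKL.inf_eq_bot,
      Submodule.map_bot])
    (by rw [← Submodule.map_sup, hKL.sup_eq_top, Submodule.map_top, range_subtype])
  exact this.imp (fun h => Submodule.map_injective_of_injective T.injective_subtype (by simpa using h))
    (fun h => Submodule.map_injective_of_injective T.injective_subtype (by simpa using h))

/-- In a direct sum of finitely generated torsion-free modules whose indecomposable summands have
local endomorphism rings, a finitely generated submodule of a summand `N` lies in a finitely
generated summand of `N`. -/
lemma Submodule.FG.exists_fg_summand [IsDomain R] [Module.IsTorsionFree R M]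
    (hloc : ∀ K : Submodule R M, K.FG → IsIndecomposableModule R K →
      IsLocalRing (Module.End R K))
    {ι : Type*} {A : ι → Submodule R M} (hA : iSupIndep A) (hA' : ⨆ i, A i = ⊤)
    (hfg : ∀ i, (A i).FG) {N : Submodule R M} (hN : IsComplemented N)
    {G : Submodule R M} (hG : G.FG) (hGN : G ≤ N) :
    ∃ D E : Submodule R M, D.FG ∧ Disjoint D E ∧ D ⊔ E = N ∧ G ≤ D := by
  obtain ⟨N', hNN'⟩ := hN
  obtain ⟨s, hs⟩ := hG.exists_finset_le_biSup (hA' ▸ le_top : G ≤ ⨆ i, A i)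
  obtain ⟨t, ht, htK, ht'⟩ := (⨆ i ∈ s, A i).exists_finset_indecomposable_of_fg
    (fg_biSup s A fun i _ => hfg i)
  have hcompl : IsComplemented (⨆ i ∈ s, A i) := by
    refine ⟨⨆ i ∈ (s : Set ι)ᶜ, A i, ?_, ?_⟩
    · exact hA.disjoint_biSup_biSup (s := (s : Set ι)) (t := (s : Set ι)ᶜ) disjoint_compl_right
    · rw [codisjoint_iff, eq_top_iff, ← hA']
      refine iSup_le fun i => ?_
      by_cases hi : i ∈ s
      · exact le_sup_of_le_left (le_biSup A hi)
      · exact le_sup_of_le_right (le_biSup (s := (s : Set ι)ᶜ) A hi)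
  obtain ⟨N₁, h1, N₁', h1', hC⟩ := t.exists_exchange_of_isLocalRing ht
    (fun T hT => hloc T (ht' T hT).1 (isIndecomposableModule_of_disjoint_sup (ht' T hT).2.1
      (ht' T hT).2.2)) (htK ▸ hcompl) hNN'
  rw [htK] at hC
  set K := ⨆ i ∈ s, A i with hK
  have hd1 : Disjoint N₁ N₁' := hNN'.disjoint.mono h1 h1'
  -- Modular law: the exchange `M = K ⊕ N₁ ⊕ N₁'` cuts out a complement of `N₁` in `N`, and it
  -- contains `G` because `K` does.
  have hsup : N₁ ⊔ N ⊓ (K ⊔ N₁') = N := by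
    rw [inf_comm, ← sup_inf_assoc_of_le _ h1, sup_left_comm, hC.sup_eq_top, top_inf_eq]
  have hdis : Disjoint (N ⊓ (K ⊔ N₁')) N₁ := by
    refine Disjoint.mono_left inf_le_right ?_
    rw [sup_comm]
    have := hC.disjoint
    rw [sup_comm] at this
    exact (hd1.disjoint_sup_right_of_disjoint_sup_left (sup_comm N₁ N₁' ▸ this.symm)).symm
  refine ⟨N ⊓ (K ⊔ N₁'), N₁, ?_, hdis, by rw [sup_comm, hsup],
    le_inf hGN (hs.trans le_sup_left)⟩
  have hKfg : K.FG := fg_biSup s A fun i _ => hfg i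
  have hcd : IsCompl (N ⊓ (K ⊔ N₁')) (N₁ ⊔ N') := by
    refine ⟨?_, ?_⟩
    · refine hdis.disjoint_sup_right_of_disjoint_sup_left ?_
      rw [sup_comm, hsup]
      exact hNN'.disjoint
    · rw [codisjoint_iff, ← sup_assoc, sup_comm _ N₁, hsup, hNN'.sup_eq_top]
  -- The projection kills `N₁` and `N₁' ≤ N'`, so its whole image already comes from the finitely
  -- generated `K`.
  have hmap : K.map ((N ⊓ (K ⊔ N₁')).projection _ hcd) = N ⊓ (K ⊔ N₁') := by
    have h3 : (N₁ ⊔ N₁').map ((N ⊓ (K ⊔ N₁')).projection _ hcd) = ⊥ := by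
      rw [eq_bot_iff, Submodule.map_le_iff_le_comap, Submodule.comap_bot, ker_projection]
      exact sup_le_sup_left h1' _
    have := congrArg (Submodule.map ((N ⊓ (K ⊔ N₁')).projection _ hcd)) hC.sup_eq_top
    rwa [Submodule.map_sup, h3, sup_bot_eq, Submodule.map_top, range_projection] at this
  rw [← hmap]
  exact hKfg.map _

/-- A countably generated summand is a direct sum of finitely generated modules as soon as finitely
generated submodules of summands lie in finitely generated summands. -/
lemma exists_iSupIndep_fg_of_countable
    (hex : ∀ N : Submodule R M, IsComplemented N → ∀ G : Submodule R M, G.FG → G ≤ N →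
      ∃ D E : Submodule R M, D.FG ∧ Disjoint D E ∧ D ⊔ E = N ∧ G ≤ D)
    {N : Submodule R M} (hN : IsComplemented N) (G : ℕ → Submodule R M) (hG : ∀ n, (G n).FG)
    (hGN : ⨆ n, G n = N) :
    ∃ D : ℕ → Submodule R M, iSupIndep D ∧ ⨆ n, D n = N ∧ ∀ n, (D n).FG := by
  -- A state `(F, E)` records the part of `N` already split off and the remainder. Each step removes
  -- from `E` a finitely generated summand containing the `E`-component of `G n`.
  let S := {p : Submodule R M × Submodule R M //
    Disjoint p.1 p.2 ∧ p.1 ⊔ p.2 = N ∧ IsComplemented p.2}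
  have step : ∀ (n : ℕ) (p : S), ∃ (q : S) (D : Submodule R M), D.FG ∧ q.1.1 = p.1.1 ⊔ D ∧
      Disjoint D q.1.2 ∧ D ⊔ q.1.2 = p.1.2 ∧ G n ≤ q.1.1 := by
    rintro n ⟨⟨F, E⟩, hd, hs, hE⟩
    dsimp only at hd hs hE
    obtain ⟨V, hV⟩ := hN
    have hEc : IsCompl E (F ⊔ V) := by
      refine ⟨?_, ?_⟩
      · refine hd.symm.disjoint_sup_right_of_disjoint_sup_left ?_
        rw [sup_comm, hs]
        exact hV.disjoint
      · rw [codisjoint_iff, ← sup_assoc, sup_comm E, hs, hV.sup_eq_top]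
    obtain ⟨D, E', hD, hDE, hDE', hGD⟩ := hex E hE ((G n).map (E.projection _ hEc))
      ((hG n).map _) (by
        rintro _ ⟨x, _, rfl⟩
        exact projection_apply_mem _ _)
    subst hDE'
    have hFD : Disjoint (F ⊔ D) E' := hDE.disjoint_sup_left_of_disjoint_sup_right hd
    refine ⟨⟨(F ⊔ D, E'), hFD, by rw [sup_assoc, hs], ?_⟩, D, hD, rfl, hDE, rfl, ?_⟩
    · obtain ⟨W, hW⟩ := hE
      refine ⟨D ⊔ W, ?_, ?_⟩
      · refine hDE.symm.disjoint_sup_right_of_disjoint_sup_left ?_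
        rw [sup_comm]
        exact hW.disjoint
      · rw [codisjoint_iff, ← sup_assoc, sup_comm E', hW.sup_eq_top]
    · intro x hx
      have hxN : x ∈ F ⊔ (D ⊔ E') := by
        rw [hs, ← hGN]
        exact le_iSup G n hx
      obtain ⟨f, hf, e, he, rfl⟩ := mem_sup.1 hxN
      have : (D ⊔ E').projection _ hEc (f + e) = e := by
        rw [map_add, (projection_apply_eq_zero_iff hEc).2 (le_sup_left (b := V) hf), zero_add,
          (projection_eq_self_iff hEc e).2 he]
      exact mem_sup.2 ⟨f, hf, e, hGD ⟨f + e, hx, this⟩, rfl⟩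
  choose next D hD hF hdis hE hGle using step
  let s : ℕ → S := fun n => Nat.rec ⟨(⊥, N), disjoint_bot_left, bot_sup_eq _, hN⟩ next n
  have hs : ∀ n, s (n + 1) = next n (s n) := fun n => rfl
  have hF' : ∀ n, (s (n + 1)).1.1 = (s n).1.1 ⊔ D n (s n) := fun n => by rw [hs, hF]
  have hE' : ∀ n, D n (s n) ⊔ (s (n + 1)).1.2 = (s n).1.2 := fun n => by rw [hs, hE]
  have hmono : Monotone fun n => (s n).1.1 :=
    monotone_nat_of_le_succ fun n => (hF' n).symm ▸ le_sup_left
  have hanti : Antitone fun n => (s n).1.2 :=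
    antitone_nat_of_succ_le fun n => (hE' n) ▸ le_sup_right
  refine ⟨fun n => D n (s n), ?_, ?_, fun n => hD n _⟩
  · rw [iSupIndep_def]
    intro n
    have h1 : Disjoint (D n (s n)) ((s (n + 1)).1.2 ⊔ (s n).1.1) := by
      refine (hs n ▸ hdis n (s n)).disjoint_sup_right_of_disjoint_sup_left ?_
      rw [hE']
      exact (s n).2.1.symm
    refine h1.mono_right (iSup₂_le fun j hj => ?_)
    rcases lt_or_gt_of_ne hj with h | h
    · refine le_sup_of_le_right (le_trans ?_ (hmono (Nat.succ_le_of_lt h)))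
      exact le_sup_right.trans (hF' j).ge
    · refine le_sup_of_le_left (le_trans ?_ (hanti (Nat.succ_le_of_lt h)))
      exact le_sup_left.trans (hE' j).le
  · apply le_antisymm
    · refine iSup_le fun n => ?_
      have h1 : D n (s n) ≤ (s n).1.2 := (hE' n) ▸ le_sup_left
      exact h1.trans (le_sup_right.trans (s n).2.2.1.le)
    · have h1 : ∀ n, (s n).1.1 ≤ ⨆ n, D n (s n) := by
        intro n
        induction n with
        | zero => exact bot_le
        | succ n ih =>
          rw [hF']
          exact sup_le ih (le_iSup (fun n => D n (s n)) n)
      rw [← hGN]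
      exact iSup_le fun n => (hGle n (s n)).trans (h1 (n + 1))

/-- Iterating `t` from `j` gives finite sets at each level. With `t i` a support of the image of the
`i`-th summand under a projection, the result spans a stable partial sum. -/
lemma exists_countable_closed {ι : Type*} (t : ι → Finset ι) (j : ι) :
    ∃ T : Set ι, T.Countable ∧ j ∈ T ∧ ∀ i ∈ T, ↑(t i) ⊆ T := by
  let S : ℕ → Set ι := fun n => Nat.rec {j} (fun _ s => ⋃ i ∈ s, (t i : Set ι)) n
  have hS : ∀ n, S (n + 1) = ⋃ i ∈ S n, (t i : Set ι) := fun n => rfl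
  refine ⟨⋃ n, S n, Set.countable_iUnion fun n => ?_, Set.mem_iUnion.2 ⟨0, rfl⟩, ?_⟩
  · induction n with
    | zero => exact Set.countable_singleton j
    | succ n ih => rw [hS]; exact ih.biUnion fun i _ => (t i).countable_toSet
  · intro i hi
    obtain ⟨n, hn⟩ := Set.mem_iUnion.1 hi
    exact (Set.subset_biUnion_of_mem (u := fun i => (t i : Set ι)) hn).trans
      (hS n ▸ Set.subset_iUnion S (n + 1))

/-- A submodule stable under the projection splits along it, as its image plus `N' ⊓ K`; hence the
image inherits a complement from `K`. -/
lemma IsComplemented.map_projection {N N' K : Submodule R M} (h : IsCompl N N')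
    (hK : IsComplemented K) (hle : K.map (N.projection N' h) ≤ K) :
    IsComplemented (K.map (N.projection N' h)) := by
  obtain ⟨V, hV⟩ := hK
  have hN : K.map (N.projection N' h) ≤ N := by
    rintro _ ⟨x, _, rfl⟩
    exact projection_apply_mem h x
  have hsup : K.map (N.projection N' h) ⊔ N' ⊓ K = K := by
    refine le_antisymm (sup_le hle inf_le_right) fun x hx => ?_
    have hx' : N.projection N' h x ∈ K.map (N.projection N' h) := ⟨x, hx, rfl⟩
    exact mem_sup.2 ⟨_, hx', x - N.projection N' h x,
      ⟨sub_projection_mem h x, sub_mem hx (hle hx')⟩, by simp⟩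
  refine ⟨N' ⊓ K ⊔ V, ?_, ?_⟩
  · refine (h.disjoint.mono hN inf_le_left).disjoint_sup_right_of_disjoint_sup_left ?_
    rw [hsup]
    exact hV.disjoint
  · rw [codisjoint_iff, ← sup_assoc, hsup, hV.sup_eq_top]

/-- Kaplansky's dévissage: summands of direct sums of finitely generated modules are direct sums
of finitely generated modules as soon as finitely generated submodules of summands lie in finitely
generated summands. -/
theorem exists_sSupIndep_fg_of_isComplemented
    (hex : ∀ N : Submodule R M, IsComplemented N → ∀ G : Submodule R M, G.FG → G ≤ N →
      ∃ D E : Submodule R M, D.FG ∧ Disjoint D E ∧ D ⊔ E = N ∧ G ≤ D)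
    {ι : Type*} {A : ι → Submodule R M} (hA : iSupIndep A) (hA' : ⨆ i, A i = ⊤)
    (hfg : ∀ i, (A i).FG) {N : Submodule R M} (hN : IsComplemented N) :
    ∃ 𝓕 : Set (Submodule R M), sSupIndep 𝓕 ∧ sSup 𝓕 = N ∧ ∀ D ∈ 𝓕, D.FG := by
  obtain ⟨N', h⟩ := hN
  set ε := N.projection N' h with hε
  let B : Set ι → Submodule R M := fun J => ⨆ i ∈ J, A i
  have hBmono : Monotone B := fun J J' hJ => biSup_mono hJ
  have hBU : ∀ J J', B (J ∪ J') = B J ⊔ B J' := fun J J' => iSup_union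
  have hBc : ∀ J, IsComplemented (B J) := fun J =>
    ⟨B Jᶜ, hA.disjoint_biSup_biSup disjoint_compl_right, by
      rw [codisjoint_iff, ← hBU, Set.union_compl_self]
      simp [B, hA']⟩
  -- Zorn runs over index sets `J` whose partial sum is stable under `ε`, together with a
  -- decomposition of its image; the order extends both the index set and the decomposition.
  let P : Set (Set ι × Set (Submodule R M)) := {p | sSupIndep p.2 ∧ (∀ D ∈ p.2, D.FG) ∧
    (B p.1).map ε = sSup p.2 ∧ (B p.1).map ε ≤ B p.1}
  obtain ⟨⟨J, 𝓕⟩, ⟨hind, hF, hJF, hJ⟩, hmax⟩ := zorn_le₀ P (by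
    intro c hc hchain
    refine ⟨(⋃ p ∈ c, p.1, ⋃ p ∈ c, p.2), ⟨?_, ?_, ?_, ?_⟩, ?_⟩
    · dsimp only
      rw [Set.biUnion_eq_iUnion]
      refine sSupIndep_iUnion_of_directed ?_ fun p => (hc p.2).1
      rintro ⟨p, hp⟩ ⟨q, hq⟩
      rcases hchain.total hp hq with hpq | hpq
      · exact ⟨⟨q, hq⟩, hpq.2, subset_rfl⟩
      · exact ⟨⟨p, hp⟩, subset_rfl, hpq.2⟩
    · intro D hD
      obtain ⟨p, hp, hD⟩ := Set.mem_iUnion₂.1 hD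
      exact (hc hp).2.1 D hD
    · dsimp only
      have h1 : B (⋃ p ∈ c, p.1) = ⨆ p ∈ c, B p.1 := by
        simp only [B, iSup_iUnion]
      have h2 : sSup (⋃ p ∈ c, p.2) = ⨆ p ∈ c, sSup p.2 := by
        simp only [sSup_iUnion]
      rw [h1, h2]
      simp only [Submodule.map_iSup]
      exact iSup_congr fun p => iSup_congr fun hp => (hc hp).2.2.1
    · dsimp only
      rw [Submodule.map_le_iff_le_comap]
      refine iSup₂_le fun i hi => ?_
      obtain ⟨p, hp, hi⟩ := Set.mem_iUnion₂.1 hi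
      rw [← Submodule.map_le_iff_le_comap]
      refine (Submodule.map_mono (le_biSup A hi)).trans (((hc hp).2.2.2).trans (hBmono ?_))
      exact Set.subset_biUnion_of_mem (u := fun p => p.1) hp
    · intro p hp
      exact ⟨Set.subset_biUnion_of_mem (u := fun p => p.1) hp,
        Set.subset_biUnion_of_mem (u := fun p => p.2) hp⟩)
  dsimp only at hind hF hJF hJ
  suffices hJu : J = Set.univ by
    refine ⟨𝓕, hind, ?_, hF⟩
    rw [← hJF, hJu]
    simp only [B, Set.mem_univ, iSup_pos, hA', Submodule.map_top, hε, range_projection]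
  by_contra hne
  obtain ⟨j, hj⟩ := (Set.ne_univ_iff_exists_notMem J).1 hne
  have ht : ∀ i, ∃ s : Finset ι, (A i).map ε ≤ ⨆ k ∈ s, A k := fun i =>
    ((hfg i).map ε).exists_finset_le_biSup (hA' ▸ le_top)
  choose t ht using ht
  obtain ⟨T, hT, hjT, hclosed⟩ := exists_countable_closed t j
  have hBT : (B T).map ε ≤ B T := by
    rw [Submodule.map_le_iff_le_comap]
    refine iSup₂_le fun i hi => ?_
    rw [← Submodule.map_le_iff_le_comap]
    exact (ht i).trans (biSup_mono fun k hk => hclosed i hi hk)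
  have hJT : (B (J ∪ T)).map ε ≤ B (J ∪ T) := by
    rw [hBU, Submodule.map_sup]
    exact sup_le_sup hJ hBT
  obtain ⟨W, hW⟩ := IsComplemented.map_projection h (hBc J) hJ
  obtain ⟨V, hV⟩ := IsComplemented.map_projection h (hBc _) hJT
  rw [← hε] at hW hV
  have hle : (B J).map ε ≤ (B (J ∪ T)).map ε :=
    Submodule.map_mono (hBmono Set.subset_union_left)
  -- `L` is the increment in `N` caused by adding `T`. It is a summand of `M`, and it is countably
  -- generated because only the indices in `T` contribute modulo `(B J).map ε`.
  set L := W ⊓ (B (J ∪ T)).map ε with hL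
  have hsup : (B J).map ε ⊔ L = (B (J ∪ T)).map ε := by
    rw [hL, ← sup_inf_assoc_of_le _ hle, hW.sup_eq_top, top_inf_eq]
  have hdis : Disjoint ((B J).map ε) L := hW.disjoint.mono_right inf_le_left
  have hLc : IsComplemented L := by
    refine ⟨(B J).map ε ⊔ V, ?_, ?_⟩
    · refine hdis.symm.disjoint_sup_right_of_disjoint_sup_left ?_
      rw [sup_comm, hsup]
      exact hV.disjoint
    · rw [codisjoint_iff, ← sup_assoc, sup_comm L, hsup, hV.sup_eq_top]
  obtain ⟨g, hg⟩ := hT.exists_eq_range ⟨j, hjT⟩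
  have hLmap : ⨆ n, ((A (g n)).map ε).map (W.projection _ hW.symm) = L := by
    have h1 : ((B (J ∪ T)).map ε).map (W.projection _ hW.symm) = L := by
      rw [← hsup, Submodule.map_sup]
      have h2 : ((B J).map ε).map (W.projection _ hW.symm) = ⊥ := by
        rw [eq_bot_iff, Submodule.map_le_iff_le_comap, Submodule.comap_bot, ker_projection]
      rw [h2, bot_sup_eq]
      ext x
      refine ⟨?_, fun hx => ⟨x, hx, (projection_eq_self_iff _ x).2 hx.1⟩⟩
      rintro ⟨y, hy, rfl⟩
      rwa [(projection_eq_self_iff _ y).2 hy.1]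
    rw [← h1, hBU, Submodule.map_sup, Submodule.map_sup]
    have h2 : ((B J).map ε).map (W.projection _ hW.symm) = ⊥ := by
      rw [eq_bot_iff, Submodule.map_le_iff_le_comap, Submodule.comap_bot, ker_projection]
    rw [h2, bot_sup_eq, hg]
    simp only [B, iSup_range, Submodule.map_iSup]
  obtain ⟨D, hDi, hDs, hDf⟩ := exists_iSupIndep_fg_of_countable hex hLc _
    (fun n => ((hfg (g n)).map ε).map _) hLmap
  have hmem : (J ∪ T, 𝓕 ∪ Set.range D) ∈ P := by
    refine ⟨?_, ?_, ?_, hJT⟩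
    · dsimp only
      have key : ∀ {𝓐 𝓑 : Set (Submodule R M)}, sSupIndep 𝓐 → Disjoint (sSup 𝓐) (sSup 𝓑) →
          ∀ X ∈ 𝓐, Disjoint X (sSup ((𝓐 ∪ 𝓑) \ {X})) := by
        intro 𝓐 𝓑 h𝓐 hd X hX
        have h3 : sSup ((𝓐 ∪ 𝓑) \ {X}) ≤ sSup (𝓐 \ {X}) ⊔ sSup 𝓑 := by
          rw [← sSup_union]
          refine sSup_le_sSup ?_
          rintro Y ⟨hY | hY, hYX⟩
          · exact Or.inl ⟨hY, hYX⟩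
          · exact Or.inr hY
        refine Disjoint.mono_right h3 ?_
        refine (h𝓐 hX).disjoint_sup_right_of_disjoint_sup_left (hd.mono_left ?_)
        exact sup_le (le_sSup hX) (sSup_le_sSup Set.sdiff_subset)
      have hd : Disjoint (sSup 𝓕) (sSup (Set.range D)) := by
        rw [← hJF, sSup_range, hDs]
        exact hdis
      rintro X (hX | hX)
      · exact key hind hd X hX
      · rw [Set.union_comm]
        exact key hDi.sSupIndep_range hd.symm X hX
    · rintro X (hX | ⟨n, rfl⟩)
      exacts [hF X hX, hDf n]
    · dsimp only
      rw [sSup_union, sSup_range, hDs, ← hJF, hsup]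
  exact hj ((hmax hmem ⟨Set.subset_union_left, Set.subset_union_left⟩).1 (Or.inr hjT))

end Kaplansky

/-! ### Closure under summands, and its formal consequences. -/

section Summands

open Submodule

lemma isSummandOf_iff {R : Type*} [CommRing R] {N M : Type*} [AddCommGroup M] [Module R M]
    [AddCommGroup N] [Module R N] :
    IsSummandOf R N M ↔ ∃ (i : N →ₗ[R] M) (p : M →ₗ[R] N), p ∘ₗ i = LinearMap.id := by
  constructor
  · rintro ⟨K, ⟨L, hKL⟩, ⟨e⟩⟩
    refine ⟨K.subtype ∘ₗ e, e.symm ∘ₗ K.projectionOnto L hKL, ?_⟩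
    ext x
    simp
  · rintro ⟨i, p, h⟩
    have hi : Function.Injective i := LinearMap.injective_of_comp_eq_id _ _ h
    have h' : ∀ x, p (i x) = x := fun x => congr($h x)
    refine ⟨LinearMap.range i, ⟨LinearMap.ker p, disjoint_def.2 ?_, codisjoint_iff.2 ?_⟩,
      ⟨LinearEquiv.ofInjective i hi⟩⟩
    · rintro _ ⟨x, rfl⟩ hx
      rw [LinearMap.mem_ker, h'] at hx
      rw [hx, map_zero]
    · refine eq_top_iff.2 fun x _ => mem_sup.2 ⟨i (p x), ⟨p x, rfl⟩, x - i (p x), ?_, by simp⟩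
      simp [h']

lemma IsSummandOf.trans {R : Type*} [CommRing R] {N M P : Type*} [AddCommGroup M] [Module R M]
    [AddCommGroup N] [Module R N] [AddCommGroup P] [Module R P] (h : IsSummandOf R N M)
    (h' : IsSummandOf R M P) : IsSummandOf R N P := by
  rw [isSummandOf_iff] at *
  obtain ⟨i, p, h⟩ := h
  obtain ⟨i', p', h'⟩ := h'
  refine ⟨i' ∘ₗ i, p ∘ₗ p', ?_⟩
  rw [LinearMap.comp_assoc, ← LinearMap.comp_assoc _ i' p', h', LinearMap.id_comp, h]

lemma IsDirectSumOfFGTorsionFree.isTorsionFree {R : Type*} [CommRing R] {M : Type w}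
    [AddCommGroup M] [Module R M] (h : IsDirectSumOfFGTorsionFree R M) :
    Module.IsTorsionFree R M := by
  obtain ⟨ι, _, A, hA, hA'⟩ := h
  let e : (DirectSum ι fun i => A i) ≃ₗ[R] M :=
    LinearEquiv.ofBijective (DirectSum.coeLinearMap A) hA
  have := fun i => (hA' i).2
  refine Function.Injective.moduleIsTorsionFree (N := ∀ i, A i) (fun m i => e.symm m i) ?_ ?_
  · intro x y hxy
    apply e.symm.injective
    exact DFinsupp.ext fun i => congrFun hxy i
  · intro c m
    ext i
    rw [map_smul]
    rfl

/-- If indecomposable finitely generated torsion-free modules have local endomorphism rings, direct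
sums of finitely generated torsion-free modules are closed under direct summands. -/
theorem directSumsClosedUnderSummands_of_indecomposablesHaveLocalEnd {R : Type u} [CommRing R]
    [IsDomain R] (h : IndecomposablesHaveLocalEnd.{u, w} R) :
    DirectSumsClosedUnderSummands.{u, w} R := by
  classical
  intro M N _ _ _ _ hM hNM
  have hTF := hM.isTorsionFree
  obtain ⟨ι, _, A, hA, hA'⟩ := hM
  obtain ⟨K, hK, ⟨e⟩⟩ := hNM
  rw [DirectSum.isInternal_submodule_iff_iSupIndep_and_iSup_eq_top] at hA
  have hfg : ∀ i, (A i).FG := fun i => Module.Finite.iff_fg.1 (hA' i).1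
  have hloc : ∀ K : Submodule R M, K.FG → IsIndecomposableModule R K →
      IsLocalRing (Module.End R K) := fun K hK hi =>
    h K (Module.Finite.iff_fg.2 hK) inferInstance hi
  obtain ⟨𝓕, h𝓕, hsup, hF⟩ := exists_sSupIndep_fg_of_isComplemented
    (fun N hN G hG hGN => hG.exists_fg_summand hloc hA.1 hA.2 hfg hN hGN) hA.1 hA.2 hfg hK
  let f : N →ₗ[R] M := K.subtype ∘ₗ e.toLinearMap
  have hf : Function.Injective f := K.injective_subtype.comp e.injective
  have hrange : LinearMap.range f = K := by simp [f, LinearMap.range_comp]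
  have hmap : ∀ D ∈ 𝓕, (D.comap f).map f = D := fun D hD => by
    rw [Submodule.map_comap_eq, hrange, inf_eq_right, ← hsup]
    exact le_sSup hD
  have hTN : Module.IsTorsionFree R N := hf.moduleIsTorsionFree f (by simp)
  refine ⟨𝓕, inferInstance, fun D => D.1.comap f, ?_, fun D => ⟨?_, inferInstance⟩⟩
  · rw [DirectSum.isInternal_submodule_iff_iSupIndep_and_iSup_eq_top]
    constructor
    · rw [iSupIndep_def]
      intro D
      rw [disjoint_iff]
      apply Submodule.map_injective_of_injective hf
      rw [Submodule.map_inf f hf, Submodule.map_bot, hmap D D.2, ← disjoint_iff]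
      refine ((sSupIndep_iff 𝓕).1 h𝓕 D).mono_right ?_
      simp only [Submodule.map_iSup]
      exact iSup₂_mono fun D' _ => (hmap D' D'.2).le
    · apply Submodule.map_injective_of_injective hf
      rw [Submodule.map_iSup, Submodule.map_top, hrange, ← hsup, sSup_eq_iSup']
      exact iSup_congr fun D => hmap D D.2
  · rw [Module.Finite.iff_fg]
    refine fg_of_fg_map_injective f hf ?_
    rw [hmap D D.2]
    exact hF D D.2

theorem addModulesAreDirectSums_of_directSumsClosedUnderSummands {R : Type u} [CommRing R]
    (h : DirectSumsClosedUnderSummands.{u, w} R) : AddModulesAreDirectSums.{u, w} R := by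
  classical
  rintro M N _ _ _ _ hM hM' ⟨ι, hN⟩
  have : IsDirectSumOfFGTorsionFree R (ι →₀ M) := by
    refine ⟨ι, inferInstance, fun i => LinearMap.range (Finsupp.lsingle i), ?_, fun i => ⟨?_, ?_⟩⟩
    · rw [DirectSum.isInternal_submodule_iff_iSupIndep_and_iSup_eq_top]
      exact ⟨iSupIndep_range_lsingle _ _ _, Finsupp.iSup_lsingle_range⟩
    · infer_instance
    · have e := LinearEquiv.ofInjective (Finsupp.lsingle (R := R) (M := M) i)
        (Finsupp.single_injective i)
      exact e.symm.injective.moduleIsTorsionFree e.symm (by simp)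
  obtain ⟨κ, hκ, A, hA, hA'⟩ := h (ι →₀ M) N this hN
  exact ⟨κ, hκ, A, hA, fun i => (hA' i).1⟩

/-- `R^(ω) ⊕ M` is a retract of `(R × M)^(ω)`: take the factor `R` of every copy and the factor `M`
of copy `0`. The universe `max u w` leaves room for `R × M`. -/
theorem summandsOfFreePlusAreDirectSums_of_addModulesAreDirectSums {R : Type u} [CommRing R]
    [IsDomain R] (h : AddModulesAreDirectSums.{u, max u w} R) :
    SummandsOfFreePlusAreDirectSums.{u, max u w} R := by
  intro M N _ _ _ _ hM hM' hN
  refine h (R × M) N inferInstance inferInstance ⟨ULift ℕ, hN.trans ?_⟩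
  rw [isSummandOf_iff]
  refine ⟨LinearMap.coprod
    (Finsupp.mapRange.linearMap (LinearMap.inl R R M) ∘ₗ Finsupp.lmapDomain R R ULift.up)
    (Finsupp.lsingle (ULift.up 0) ∘ₗ LinearMap.inr R R M),
    LinearMap.prod (Finsupp.mapRange.linearMap (LinearMap.fst R R M) ∘ₗ
      Finsupp.lmapDomain (R × M) R ULift.down)
      (LinearMap.snd R R M ∘ₗ Finsupp.lapply (ULift.up 0)), ?_⟩
  ext
  · simp [show ((0, 0) : R × M) = 0 from rfl, Finsupp.single_apply]
  · simp [Finsupp.single_apply, apply_ite Prod.snd]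
  · simp
  · simp

end Summands

/-! ### Descent of local endomorphism rings to integral extensions. -/

section IntegralExtension

open Submodule

/-- Clearing denominators. In a torsion-free module it makes the `S`-spans of disjoint
`R`-submodules disjoint. -/
lemma Submodule.exists_smul_mem_of_mem_span {R S M : Type*} [CommRing R] [IsDomain R] [CommRing S]
    [Algebra R S] [AddCommGroup M] [Module R M] [Module S M] [IsScalarTower R S M]
    (hfrac : ∀ s : S, ∃ r : R, r ≠ 0 ∧ ∃ a : R, r • s = algebraMap R S a) (K : Submodule R M)
    {x : M} (hx : x ∈ span S (K : Set M)) : ∃ r : R, r ≠ 0 ∧ r • x ∈ K := by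
  induction hx using Submodule.span_induction with
  | mem x hx => exact ⟨1, one_ne_zero, by simpa using hx⟩
  | zero => exact ⟨1, one_ne_zero, by simp⟩
  | add x y _ _ hx hy =>
    obtain ⟨r, hr, hx⟩ := hx
    obtain ⟨t, ht, hy⟩ := hy
    refine ⟨r * t, mul_ne_zero hr ht, ?_⟩
    rw [smul_add, mul_smul, mul_smul, smul_comm r t x]
    exact add_mem (K.smul_mem t hx) (K.smul_mem r hy)
  | smul s x _ hx =>
    obtain ⟨r, hr, hx⟩ := hx
    obtain ⟨t, ht, a, ha⟩ := hfrac s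
    refine ⟨t * r, mul_ne_zero ht hr, ?_⟩
    have : (t * r) • s • x = a • r • x := by
      rw [mul_smul, smul_comm r s x, ← smul_assoc t s, ha, algebraMap_smul]
    rw [this]
    exact K.smul_mem a hx

/-- Locality of the endomorphism rings of indecomposables passes to integral extensions inside the field of fractions. -/
theorem IndecomposablesHaveLocalEnd.of_isIntegral {R : Type u} {S : Type v} [CommRing R]
    [IsDomain R] [CommRing S] [IsDomain S] [Algebra R S] [Algebra.IsIntegral R S]
    (hinj : Function.Injective (algebraMap R S))
    (hfrac : ∀ s : S, ∃ r : R, r ≠ 0 ∧ ∃ a : R, r • s = algebraMap R S a)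
    (h : IndecomposablesHaveLocalEnd.{u, w} R) : IndecomposablesHaveLocalEnd.{v, w} S := by
  intro M _ _ hfin htf ⟨hnt, hind⟩
  let _ : Module R M := Module.compHom M (algebraMap R S)
  have : IsScalarTower R S M := IsScalarTower.of_algebraMap_smul fun _ _ => rfl
  have htfR : Module.IsTorsionFree R M := by
    refine Module.IsTorsionFree.of_smul_eq_zero fun r m hrm => ?_
    rw [← algebraMap_smul S r m, smul_eq_zero] at hrm
    exact hrm.imp_left fun h0 => hinj (by simpa using h0)
  refine IsLocalRing.of_isUnit_or_isUnit_one_sub_self fun f => ?_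
  obtain ⟨n, g, hg⟩ := Module.Finite.exists_fin (R := S) (M := M)
  have hc : ∀ j, ∃ c : Fin n → S, ∑ k, c k • g k = f (g j) := fun j => by
    rw [← Submodule.mem_span_range_iff_exists_fun, hg]
    trivial
  choose c hc using hc
  -- Adjoining the finitely many entries of a matrix of `f` gives a ring finite over `R`, by
  -- integrality. The `S₀`-span of the generators is then an `f`-stable lattice finite over `R`; it
  -- depends on `f`.
  let S₀ : Subalgebra R S := Algebra.adjoin R (Set.range fun p : Fin n × Fin n => c p.1 p.2)
  have hS₀ : Module.Finite R S₀ := by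
    have := fg_adjoin_of_finite (R := R) (s := Set.range fun p : Fin n × Fin n => c p.1 p.2)
      (Set.finite_range _) fun x _ => Algebra.IsIntegral.isIntegral x
    exact Module.Finite.of_fg this
  let M₁ : Submodule S₀ M := span S₀ (Set.range g)
  have hfM₁ : ∀ x ∈ M₁, f x ∈ M₁ := by
    intro x hx
    induction hx using Submodule.span_induction with
    | mem x hx =>
      obtain ⟨j, rfl⟩ := hx
      rw [← hc]
      refine sum_mem fun k _ => ?_
      exact M₁.smul_mem (⟨c j k, Algebra.subset_adjoin ⟨(j, k), rfl⟩⟩ : S₀)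
        (subset_span ⟨k, rfl⟩)
    | zero => simp
    | add x y _ _ hx hy => rw [map_add]; exact add_mem hx hy
    | smul s x _ hx =>
      have : f (s • x) = s • f x := f.map_smul (s : S) x
      rw [this]
      exact M₁.smul_mem s hx
  have hfinM₁ : Module.Finite S₀ M₁ := Module.Finite.of_fg (fg_span (Set.finite_range g))
  let M₀ : Submodule R M := M₁.restrictScalars R
  have hfinM₀ : Module.Finite R M₀ := by
    have : IsScalarTower R S₀ M₀ := ⟨fun r s x => Subtype.ext (smul_assoc r (s : S) (x : M))⟩
    have : Module.Finite S₀ M₀ := hfinM₁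
    exact Module.Finite.trans S₀ M₀
  have hgM₀ : ∀ j, g j ∈ M₀ := fun j => subset_span ⟨j, rfl⟩
  have hspan : span S (M₀ : Set M) = ⊤ := by
    rw [eq_top_iff, ← hg]
    exact span_mono (by rintro _ ⟨j, rfl⟩; exact hgM₀ j)
  have hne : M₀ ≠ ⊥ := by
    intro h0
    rw [h0] at hspan
    simp at hspan
  have hindec : IsIndecomposableModule R M₀ := by
    refine isIndecomposableModule_of_disjoint_sup hne fun K L hd hs => ?_
    have hcompl : IsCompl (span S (K : Set M)) (span S (L : Set M)) := by
      refine ⟨disjoint_def.2 fun x hK hL => ?_, ?_⟩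
      · obtain ⟨r, hr, hrx⟩ := exists_smul_mem_of_mem_span hfrac K hK
        obtain ⟨t, ht, htx⟩ := exists_smul_mem_of_mem_span hfrac L hL
        have : (r * t) • x = 0 := disjoint_def.1 hd _
          (by rw [mul_comm, mul_smul]; exact K.smul_mem t hrx)
          (by rw [mul_smul]; exact L.smul_mem r htx)
        exact (smul_eq_zero.1 this).resolve_left (mul_ne_zero hr ht)
      · rw [codisjoint_iff, eq_top_iff, ← hspan, span_le]
        intro x hx
        rw [← hs] at hx
        obtain ⟨k, hk, l, hl, rfl⟩ := mem_sup.1 hx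
        exact add_mem (mem_sup_left (subset_span hk)) (mem_sup_right (subset_span hl))
    refine (hind _ _ hcompl).imp (fun h0 => ?_) (fun h0 => ?_)
    all_goals
      rw [eq_bot_iff]
      intro x hx
      have := h0 ▸ (subset_span (R := S) hx)
      simpa using this
  have hloc := h M₀ hfinM₀ inferInstance hindec
  -- `M₀` generates `M` over `S`, and a surjective endomorphism of a finitely generated module is
  -- injective.
  have key : ∀ e : Module.End S M, (∀ x ∈ M₀, ∃ y, e y = x) → IsUnit e := by
    intro e he
    rw [Module.End.isUnit_iff]
    have hsurj : Function.Surjective e := by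
      rw [← LinearMap.range_eq_top, eq_top_iff, ← hspan, span_le]
      exact fun x hx => he x hx
    exact ⟨OrzechProperty.injective_of_surjective_endomorphism e hsurj, hsurj⟩
  let f₀ : Module.End R M₀ := (f.restrictScalars R).restrict hfM₁
  refine (IsLocalRing.isUnit_or_isUnit_of_add_one (add_sub_cancel f₀ 1)).imp
    (fun hu => key _ fun x hx => ?_) (fun hu => key _ fun x hx => ?_)
  all_goals
    obtain ⟨y, hy⟩ := ((Module.End.isUnit_iff _).1 hu).2 ⟨x, hx⟩
    exact ⟨y, congrArg Subtype.val hy⟩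

theorem IndecomposablesHaveLocalEnd.subalgebra {R : Type u} [CommRing R] [IsDomain R]
    {Q : Type v} [Field Q] [Algebra R Q] [IsFractionRing R Q] (S : Subalgebra R Q)
    (hS : S ≤ integralClosure R Q) (h : IndecomposablesHaveLocalEnd.{u, w} R) :
    IndecomposablesHaveLocalEnd.{v, w} S := by
  have hint : Algebra.IsIntegral R S := ⟨fun s => by
    have := hS s.2
    exact (isIntegral_algHom_iff S.val Subtype.val_injective).1 this⟩
  refine h.of_isIntegral ?_ fun s => ?_
  · intro a b hab
    exact IsFractionRing.injective R Q (congrArg Subtype.val hab)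
  · obtain ⟨r, hs⟩ := IsLocalization.exists_integer_multiple (nonZeroDivisors R) (s : Q)
    obtain ⟨a, ha⟩ := hs
    exact ⟨r, nonZeroDivisors.ne_zero r.2, a, Subtype.ext ha.symm⟩

end IntegralExtension

/-! ### Almost idempotent endomorphisms in dimension one. -/

section LocalRing

open Submodule IsLocalRing Polynomial

/-- Nakayama: `M = u(M) + 𝔪M`. -/
lemma LinearMap.surjective_of_range_sub_le {R : Type*} [CommRing R] [IsLocalRing R] {M : Type*}
    [AddCommGroup M] [Module R M] [Module.Finite R M] {u : Module.End R M}
    (h : LinearMap.range (1 - u) ≤ maximalIdeal R • ⊤) : Function.Surjective u := by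
  rw [← LinearMap.range_eq_top, eq_top_iff]
  refine le_of_le_smul_of_le_jacobson_bot (I := maximalIdeal R) Module.Finite.fg_top
    (maximalIdeal_le_jacobson ⊥) fun x _ => ?_
  exact mem_sup.2 ⟨u x, ⟨x, rfl⟩, (1 - u) x, h ⟨x, rfl⟩, by simp⟩

lemma Module.End.isUnit_of_range_sub_le {R : Type*} [CommRing R] [IsLocalRing R] {M : Type*}
    [AddCommGroup M] [Module R M] [Module.Finite R M] {u : Module.End R M}
    (h : LinearMap.range (1 - u) ≤ maximalIdeal R • ⊤) : IsUnit u := by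
  have hs := LinearMap.surjective_of_range_sub_le h
  exact (Module.End.isUnit_iff u).2
    ⟨OrzechProperty.injective_of_surjective_endomorphism u hs, hs⟩

/-- Splitting off the part of a polynomial below its first unit coefficient. -/
lemma Polynomial.Monic.exists_eq_X_pow_mul_add {R : Type*} [CommRing R] [IsLocalRing R] {p : R[X]}
    (hp : p.Monic) : ∃ (a : ℕ) (q p₁ : R[X]), p = X ^ a * q + p₁ ∧ IsUnit (q.coeff 0) ∧
      (∀ i, p₁.coeff i ∈ maximalIdeal R) ∧ (a = 0 → p₁ = 0) := by
  classical
  have hex : ∃ i, IsUnit (p.coeff i) := ⟨p.natDegree, by simp [hp]⟩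
  set a := Nat.find hex with ha
  have hmod := modByMonic_add_div p (X ^ a : R[X])
  have hdeg : (p %ₘ (X ^ a)).degree < a := by
    simpa using degree_modByMonic_lt p (monic_X_pow (R := R) a)
  have hcoeff : ∀ i, p.coeff i = (p %ₘ (X ^ a)).coeff i + (X ^ a * (p /ₘ (X ^ a))).coeff i :=
    fun i => by rw [← coeff_add, hmod]
  refine ⟨a, p /ₘ (X ^ a), p %ₘ (X ^ a), by rw [add_comm, hmod], ?_, fun i => ?_, fun h => ?_⟩
  · have := hcoeff a
    rw [coeff_eq_zero_of_degree_lt hdeg, zero_add] at this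
    have h2 := coeff_X_pow_mul (p /ₘ (X ^ a : R[X])) a 0
    rw [zero_add] at h2
    rw [← h2, ← this]
    exact Nat.find_spec hex
  · by_cases hi : i < a
    · have := hcoeff i
      rw [coeff_X_pow_mul', if_neg (by omega), add_zero] at this
      rw [← this]
      exact (mem_maximalIdeal _).2 (Nat.find_min hex hi)
    · rw [coeff_eq_zero_of_degree_lt (hdeg.trans_le (by exact_mod_cast not_lt.1 hi))]
      exact zero_mem _
  · rw [h, pow_zero, modByMonic_one]

/-- Modulo `r` all coefficients are nilpotent, hence so is the polynomial. -/
lemma Polynomial.exists_C_dvd_pow {R : Type*} [CommRing R] {r : R} {p : R[X]}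
    (h : ∀ i, p.coeff i ∈ (Ideal.span {r}).radical) : ∃ N, C r ∣ p ^ N := by
  have : IsNilpotent (p.map (Ideal.Quotient.mk (Ideal.span {r}))) := by
    rw [Polynomial.isNilpotent_iff]
    intro i
    obtain ⟨n, hn⟩ := h i
    refine ⟨n, ?_⟩
    rw [coeff_map, ← map_pow, Ideal.Quotient.eq_zero_iff_mem]
    exact hn
  obtain ⟨N, hN⟩ := this
  refine ⟨N, ?_⟩
  rw [C_dvd_iff_dvd_coeff]
  intro i
  rw [← Ideal.mem_span_singleton, ← Ideal.Quotient.eq_zero_iff_mem, ← coeff_map,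
    Polynomial.map_pow, hN, coeff_zero]

/-- Nonzero primes are maximal, so a prime containing `r` can only be `𝔪`. This is the sole use of
the dimension. -/
lemma IsLocalRing.maximalIdeal_le_radical_of_ringKrullDim_le_one {R : Type*} [CommRing R]
    [IsDomain R] [IsLocalRing R] (hdim : ringKrullDim R ≤ 1) {r : R} (hr : r ≠ 0) :
    maximalIdeal R ≤ (Ideal.span {r}).radical := by
  have := (Ring.krullDimLE_iff (n := 1) (R := R)).2 hdim
  rw [Ideal.radical_eq_sInf]
  refine le_sInf fun J hJ => ?_
  have hJm : J.IsMaximal := hJ.2.isMaximal_of_ne_bot fun h => hr (by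
    have := hJ.1 (Ideal.mem_span_singleton_self r)
    simpa [h] using this)
  rw [eq_maximalIdeal hJm]

/-- Over a local domain of dimension one, a non-local endomorphism ring of a finitely generated
module contains an endomorphism idempotent modulo `r` and non-trivial modulo the maximal ideal. -/
lemma Module.End.exists_almost_idempotent {R : Type*} [CommRing R] [IsDomain R] [IsLocalRing R]
    (hdim : ringKrullDim R ≤ 1) {M : Type*} [AddCommGroup M] [Module R M] [Module.Finite R M]
    {f : Module.End R M} (hf : ¬ IsUnit f) (hf' : ¬ IsUnit (1 - f)) {r : R} (hr : r ≠ 0) :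
    ∃ e g : Module.End R M, e * e = e + r • g ∧
      ¬ LinearMap.range e ≤ maximalIdeal R • ⊤ ∧
      ¬ LinearMap.range (1 - e) ≤ maximalIdeal R • ⊤ := by
  obtain ⟨p, hp, hpf⟩ := LinearMap.exists_monic_and_aeval_eq_zero R f
  obtain ⟨a, q, p₁, hpq, hq, hp₁, ha⟩ := hp.exists_eq_X_pow_mul_add
  have hcommute : ∀ g : R[X], aeval f g * f = f * aeval f g := fun g => by
    have := congrArg (aeval f) (mul_comm g X)
    rwa [map_mul, map_mul, aeval_X] at this
  have ha0 : a ≠ 0 := by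
    rintro rfl
    refine hf ?_
    obtain rfl : p = q := by rw [hpq, ha rfl]; simp
    rw [← divX_mul_X_add p, map_add, map_mul, aeval_X, aeval_C] at hpf
    obtain ⟨c, hc⟩ := hq
    rw [← hc] at hpf
    have hcomm : f * aeval f p.divX = aeval f p.divX * f := (hcommute _).symm
    have hdf : aeval f p.divX * f = -((c : R) • 1) := by
      rw [← Algebra.algebraMap_eq_smul_one]
      exact eq_neg_of_add_eq_zero_left hpf
    refine ⟨⟨f, -(((c⁻¹ : Rˣ) : R) • aeval f p.divX), ?_, ?_⟩, rfl⟩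
    · rw [mul_neg, mul_smul_comm, hcomm, hdf, smul_neg, neg_neg, smul_smul, Units.inv_mul, one_smul]
    · rw [neg_mul, smul_mul_assoc, hdf, smul_neg, neg_neg, smul_smul, Units.inv_mul, one_smul]
  have hc : IsCoprime (X ^ a) q := by
    refine IsCoprime.pow_left ?_
    obtain ⟨c, hc⟩ := hq
    refine ⟨-(C (c⁻¹ : Rˣ) : R[X]) * q.divX, C ((c⁻¹ : Rˣ) : R), ?_⟩
    have h1 : (C ((c⁻¹ : Rˣ) : R) : R[X]) * C (c : R) = 1 := by rw [← C_mul]; simp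
    have h2 := divX_mul_X_add q
    rw [← hc] at h2
    linear_combination (C ((c⁻¹ : Rˣ) : R) : R[X]) * (-h2) + h1
  obtain ⟨N, p₂, hN⟩ := Polynomial.exists_C_dvd_pow fun i =>
    IsLocalRing.maximalIdeal_le_radical_of_ringKrullDim_le_one hdim hr (hp₁ i)
  -- The idempotent is `V q^(N+1)`, evaluated at `f`. Since `X^a q` acts as `-p₁`, its defect is a
  -- multiple of `p₁^(N+1)`: the factor `p₁^N` supplies `r`, and the extra `p₁` keeps the image in
  -- `𝔪M` even when `N = 0`.
  obtain ⟨U, V, hUV⟩ := hc.pow (m := N + 1) (n := N + 1)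
  have hm : ∀ g h : Module.End R M, LinearMap.range g ≤ maximalIdeal R • ⊤ →
      LinearMap.range (h * g) ≤ maximalIdeal R • ⊤ := by
    intro g h hg
    rw [Module.End.mul_eq_comp, LinearMap.range_comp]
    refine (Submodule.map_mono hg).trans ?_
    rw [Submodule.map_smul'']
    exact smul_mono_right _ le_top
  have hp₁m : LinearMap.range (aeval f p₁) ≤ maximalIdeal R • ⊤ := by
    rintro _ ⟨x, rfl⟩
    rw [aeval_eq_sum_range, LinearMap.sum_apply]
    exact sum_mem fun i _ => smul_mem_smul (hp₁ i) trivial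
  have hpow : aeval f ((X ^ a) ^ (N + 1) * q ^ (N + 1)) = aeval f ((-p₁) ^ (N + 1)) := by
    rw [← mul_pow, map_pow, map_pow]
    congr 1
    rw [hpq, map_add] at hpf
    rw [map_neg]
    exact eq_neg_of_add_eq_zero_left hpf
  have hone : 1 - aeval f (V * q ^ (N + 1)) = aeval f (U * (X ^ a) ^ (N + 1)) := by
    rw [← map_one (aeval (R := R) f), ← map_sub, ← hUV, add_sub_cancel_right]
  have hpow0 : ∀ h : Module.End R M, LinearMap.range (h * aeval f ((-p₁) ^ (N + 1))) ≤
      maximalIdeal R • ⊤ := fun h => by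
    rw [show (-p₁) ^ (N + 1) = (-1) ^ (N + 1) * p₁ ^ N * p₁ by rw [neg_pow]; ring, map_mul,
      ← mul_assoc]
    exact hm _ _ hp₁m
  refine ⟨aeval f (V * q ^ (N + 1)), aeval f (-(U * V * (-1) ^ (N + 1) * p₂ * p₁)), ?_, ?_, ?_⟩
  · have h1 : V * q ^ (N + 1) * (V * q ^ (N + 1)) =
        V * q ^ (N + 1) - U * V * ((X ^ a) ^ (N + 1) * q ^ (N + 1)) := by
      linear_combination (V * q ^ (N + 1)) * hUV
    rw [← map_mul, h1, map_sub, map_mul _ (U * V), hpow, ← map_mul, ← map_smul, ← map_sub, ← map_add]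
    congr 1
    rw [smul_eq_C_mul, neg_pow, pow_succ p₁, hN]
    ring
  · intro h
    have hu := Module.End.isUnit_of_range_sub_le (u := 1 - aeval f (V * q ^ (N + 1)))
      (by rwa [sub_sub_cancel])
    rw [hone, map_mul, map_pow, map_pow, aeval_X, ← pow_mul] at hu
    have hcom : Commute (aeval f U) (f ^ (a * (N + 1))) :=
      (Commute.pow_right (hcommute U) _)
    exact hf ((isUnit_pow_iff (by positivity)).1 (hcom.isUnit_mul_iff.1 hu).2)
  · intro h
    -- If `1 - e` vanishes modulo `𝔪`, then so does this power of `f`, because its product with `e`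
    -- is a multiple of `p₁`. Hence `1 - f^k` is a unit, and `1 - f` divides it.
    have h2 : LinearMap.range (f ^ (a * (N + 1))) ≤ maximalIdeal R • ⊤ := by
      have h3 : f ^ (a * (N + 1)) = f ^ (a * (N + 1)) * (1 - aeval f (V * q ^ (N + 1))) +
          aeval f V * aeval f ((-p₁) ^ (N + 1)) := by
        rw [← hpow, ← map_mul, ← aeval_X (R := R) f, ← map_pow, aeval_X (R := R) f,
          ← map_one (aeval (R := R) f), ← map_sub, ← map_mul, ← map_add]
        congr 1
        ring
      rw [h3]
      refine (LinearMap.range_add_le _ _).trans (sup_le (hm _ _ h) (hpow0 _))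
    have hu := Module.End.isUnit_of_range_sub_le (u := 1 - f ^ (a * (N + 1)))
      (by rwa [sub_sub_cancel])
    rw [← mul_neg_geom_sum] at hu
    have hcom : Commute (1 - f) (∑ i ∈ Finset.range (a * (N + 1)), f ^ i) := by
      refine Commute.sum_right _ _ _ fun i _ => ?_
      exact ((Commute.one_left _).sub_left (Commute.refl f)).pow_right i
    exact hf' (hcom.isUnit_mul_iff.1 hu).1

end LocalRing

/-! ### Splitting an endomorphism that is idempotent up to maps through `F`. -/

section Telescope

open Submodule

variable {R : Type*} [CommRing R] {M F X P Z : Type*} [AddCommGroup M] [Module R M]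
  [AddCommGroup F] [Module R F] [AddCommGroup X] [Module R X] [AddCommGroup P] [Module R P]
  [AddCommGroup Z] [Module R Z]

/-- A linear map onto the union of a chain of submodules is split as soon as it has partial
sections, compatible with the chain up to a shift. -/
lemma LinearMap.exists_rightInverse_of_exhaustion (Ψ : P →ₗ[R] X) (E : ℕ → Submodule R X)
    (hmono : Monotone E) (hE : ∀ x, ∃ n, x ∈ E n)
    (hs : ∀ n, ∃ s : X →ₗ[R] P, (∀ x ∈ E n, Ψ (s x) = x) ∧ ∀ x, Ψ (s x) ∈ E (n + 1)) :
    ∃ S : X →ₗ[R] P, Ψ ∘ₗ S = LinearMap.id := by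
  choose s hs hs' using hs
  -- Each term corrects the error of the previous one by the next partial section. On `E n` the
  -- error of `t n` is zero, so the sequence is stationary there and has a limit.
  let t : ℕ → (X →ₗ[R] P) := fun n =>
    Nat.rec (s 0) (fun n t => t + s (n + 1) ∘ₗ (LinearMap.id - Ψ ∘ₗ t)) n
  have ht : ∀ n x, t (n + 1) x = t n x + s (n + 1) (x - Ψ (t n x)) := fun n x => rfl
  have key : ∀ n, (∀ x ∈ E n, Ψ (t n x) = x) ∧ ∀ x, Ψ (t n x) ∈ E (n + 1) := by
    intro n
    induction n with
    | zero => exact ⟨hs 0, hs' 0⟩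
    | succ n ih =>
      refine ⟨fun x hx => ?_, fun x => ?_⟩
      · rw [ht, map_add, hs (n + 1) _ (sub_mem hx (ih.2 x)), add_sub_cancel]
      · rw [ht, map_add]
        exact add_mem (hmono (Nat.le_succ _) (ih.2 x)) (hs' _ _)
  have hconst : ∀ n k x, x ∈ E n → t (n + k) x = t n x := by
    intro n k x hx
    induction k with
    | zero => rfl
    | succ k ih =>
      rw [← add_assoc, ht, (key (n + k)).1 x (hmono (Nat.le_add_right n k) hx), sub_self, map_zero,
        add_zero, ih]
  choose N hN using hE
  have hval : ∀ n x, x ∈ E n → t (N x) x = t n x := by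
    intro n x hx
    rcases le_total n (N x) with h | h
    · obtain ⟨k, hk⟩ := Nat.exists_eq_add_of_le h
      rw [hk, hconst n k x hx]
    · obtain ⟨k, rfl⟩ := Nat.exists_eq_add_of_le h
      rw [hconst _ k x (hN x)]
  refine ⟨{ toFun := fun x => t (N x) x, map_add' := fun x y => ?_, map_smul' := fun c x => ?_ },
    ?_⟩
  · have hx := hmono (le_max_left (N x) (N y)) (hN x)
    have hy := hmono (le_max_right (N x) (N y)) (hN y)
    rw [hval _ _ (add_mem hx hy), hval _ _ hx, hval _ _ hy, map_add]
  · rw [hval (N x) _ (smul_mem _ c (hN x)), map_smul, RingHom.id_apply]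
  · ext x
    exact (key (N x)).1 x (hN x)

variable (e : M →ₗ[R] M) (α : M →ₗ[R] F) (β : F →ₗ[R] M)

/-- The relations of the telescope. -/
noncomputable def telescopeRel : (ℕ →₀ M) →ₗ[R] (ℕ →₀ M) × (ℕ →₀ F) :=
  Finsupp.lsum ℕ fun n => LinearMap.inl R (ℕ →₀ M) (ℕ →₀ F) ∘ₗ Finsupp.lsingle n -
    LinearMap.inl R (ℕ →₀ M) (ℕ →₀ F) ∘ₗ Finsupp.lsingle (n + 1) ∘ₗ e -
    LinearMap.inr R (ℕ →₀ M) (ℕ →₀ F) ∘ₗ Finsupp.lsingle n ∘ₗ α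

/-- The colimit of `M → M × F → M × F × F → ⋯`, where the first copy of `M` is mapped by
`m ↦ (e m, α m)` at each step. -/
abbrev Telescope : Type _ := ((ℕ →₀ M) × (ℕ →₀ F)) ⧸ LinearMap.range (telescopeRel e α)

namespace Telescope

/-- The copy of `M` at stage `n`. -/
noncomputable def μ (n : ℕ) : M →ₗ[R] Telescope e α :=
  (LinearMap.range (telescopeRel e α)).mkQ ∘ₗ LinearMap.inl R _ _ ∘ₗ Finsupp.lsingle n

/-- The copy of `F` appearing at stage `n + 1`. -/
noncomputable def χ (n : ℕ) : F →ₗ[R] Telescope e α :=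
  (LinearMap.range (telescopeRel e α)).mkQ ∘ₗ LinearMap.inr R _ _ ∘ₗ Finsupp.lsingle n

lemma μ_eq (n : ℕ) (m : M) : μ e α n m = μ e α (n + 1) (e m) + χ e α n (α m) := by
  have h : (LinearMap.range (telescopeRel e α)).mkQ (telescopeRel e α (Finsupp.single n m)) = 0 := by
    rw [mkQ_apply, Quotient.mk_eq_zero]
    exact ⟨_, rfl⟩
  rw [telescopeRel, Finsupp.lsum_single, LinearMap.sub_apply, LinearMap.sub_apply, map_sub,
    map_sub, sub_sub, sub_eq_zero] at h
  exact h

/-- The universal property of the telescope. -/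
noncomputable def desc (a : ℕ → M →ₗ[R] Z) (b : ℕ → F →ₗ[R] Z)
    (h : ∀ n m, a n m = a (n + 1) (e m) + b n (α m)) : Telescope e α →ₗ[R] Z :=
  (LinearMap.range (telescopeRel e α)).liftQ
    ((Finsupp.lsum ℕ a).coprod (Finsupp.lsum ℕ b)) (by
      rw [LinearMap.range_le_ker_iff]
      refine Finsupp.lhom_ext fun n m => ?_
      rw [LinearMap.comp_apply, telescopeRel, Finsupp.lsum_single]
      simp only [LinearMap.sub_apply, map_sub, LinearMap.comp_apply, LinearMap.coprod_inl,
        ← LinearMap.comp_apply (LinearMap.coprod _ _), LinearMap.coprod_inr]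
      simp [h n m])

variable {e α}

@[simp] lemma desc_μ {a : ℕ → M →ₗ[R] Z} {b : ℕ → F →ₗ[R] Z}
    (h : ∀ n m, a n m = a (n + 1) (e m) + b n (α m)) (n : ℕ) (m : M) :
    desc e α a b h (μ e α n m) = a n m := by
  simp [desc, μ]

@[simp] lemma desc_χ {a : ℕ → M →ₗ[R] Z} {b : ℕ → F →ₗ[R] Z}
    (h : ∀ n m, a n m = a (n + 1) (e m) + b n (α m)) (n : ℕ) (x : F) :
    desc e α a b h (χ e α n x) = b n x := by
  simp [desc, χ]

lemma eq_top_of_mem {E : Submodule R (Telescope e α)} (hμ : ∀ n m, μ e α n m ∈ E)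
    (hχ : ∀ n x, χ e α n x ∈ E) (x : Telescope e α) : x ∈ E := by
  obtain ⟨⟨u, v⟩, rfl⟩ := mkQ_surjective _ x
  rw [show ((u, v) : (ℕ →₀ M) × (ℕ →₀ F)) = (u, 0) + (0, v) by simp, map_add]
  refine add_mem ?_ ?_
  · induction u using Finsupp.induction_linear with
    | zero => exact zero_mem E
    | add u u' hu hu' =>
      rw [show ((u + u', 0) : (ℕ →₀ M) × (ℕ →₀ F)) = (u, 0) + (u', 0) by simp, map_add]
      exact add_mem hu hu'
    | single n m => exact hμ n m
  · induction v using Finsupp.induction_linear with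
    | zero => exact zero_mem E
    | add u u' hu hu' =>
      rw [show ((0, u + u') : (ℕ →₀ M) × (ℕ →₀ F)) = (0, u) + (0, u') by simp, map_add]
      exact add_mem hu hu'
    | single n m => exact hχ n m

variable (e α)

/-- The image of stage `n` in the telescope. -/
noncomputable def stage (n : ℕ) : Submodule R (Telescope e α) :=
  LinearMap.range (μ e α n) ⊔ ⨆ i : Fin n, LinearMap.range (χ e α i)

lemma μ_mem_stage (n : ℕ) (m : M) : μ e α n m ∈ stage e α n := mem_sup_left ⟨m, rfl⟩

lemma χ_mem_stage {i n : ℕ} (h : i < n) (x : F) : χ e α i x ∈ stage e α n :=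
  mem_sup_right (mem_iSup_of_mem (⟨i, h⟩ : Fin n) ⟨x, rfl⟩)

variable {e α} in
lemma stage_le_iff {n : ℕ} {E : Submodule R (Telescope e α)} :
    stage e α n ≤ E ↔ (∀ m, μ e α n m ∈ E) ∧ ∀ i < n, ∀ x, χ e α i x ∈ E := by
  refine ⟨fun h => ⟨fun m => h (μ_mem_stage e α n m), fun i hi x => h (χ_mem_stage e α hi x)⟩,
    fun h => sup_le ?_ (iSup_le fun i => ?_)⟩
  · rintro _ ⟨m, rfl⟩
    exact h.1 m
  · rintro _ ⟨x, rfl⟩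
    exact h.2 i i.2 x

lemma stage_mono : Monotone (stage e α) := by
  refine monotone_nat_of_le_succ fun n => stage_le_iff.2 ⟨fun m => ?_, fun i hi x => ?_⟩
  · rw [μ_eq]
    exact add_mem (μ_mem_stage e α _ _) (χ_mem_stage e α (Nat.lt_succ_self n) _)
  · exact χ_mem_stage e α (hi.trans (Nat.lt_succ_self n)) x

lemma exists_mem_stage (x : Telescope e α) : ∃ n, x ∈ stage e α n := by
  rw [← mem_iSup_of_directed _ (stage_mono e α).directed_le]
  exact eq_top_of_mem (fun n m => mem_iSup_of_mem n (μ_mem_stage e α n m))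
    (fun n x => mem_iSup_of_mem (n + 1) (χ_mem_stage e α (Nat.lt_succ_self n) x)) x

/-- The presentation of the telescope as a quotient of `M` plus copies of `F`. -/
noncomputable def cover : M × ((ℕ →₀ F) × (ℕ →₀ F)) →ₗ[R] Telescope e α :=
  (μ e α 0).coprod ((Finsupp.lsum ℕ (χ e α)).coprod
    (Finsupp.lsum ℕ fun n => μ e α n ∘ₗ β))

/-- The first family of copies of `F` in the source of `cover`. -/
noncomputable def ofLeft (n : ℕ) : F →ₗ[R] M × ((ℕ →₀ F) × (ℕ →₀ F)) :=
  LinearMap.inr R _ _ ∘ₗ LinearMap.inl R _ _ ∘ₗ Finsupp.lsingle n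

/-- The second family of copies of `F` in the source of `cover`. -/
noncomputable def ofRight (n : ℕ) : F →ₗ[R] M × ((ℕ →₀ F) × (ℕ →₀ F)) :=
  LinearMap.inr R _ _ ∘ₗ LinearMap.inr R _ _ ∘ₗ Finsupp.lsingle n

@[simp] lemma cover_ofLeft (n : ℕ) (x : F) : cover e α β (ofLeft (R := R) n x) = χ e α n x := by
  simp [cover, ofLeft]

@[simp] lemma cover_ofRight (n : ℕ) (x : F) :
    cover e α β (ofRight (R := R) n x) = μ e α n (β x) := by
  simp [cover, ofRight]

-- Modulo maps through `F`, the transition map is the identity on the image of `e`. This lets `e m`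
-- be moved back from stage `n + 1` to stage `n`.
variable {β} in
lemma μ_succ_eq (h : ∀ m, e (e m) = e m + β (α m)) (n : ℕ) (m : M) :
    μ e α (n + 1) (e m) = μ e α n (e m) - μ e α (n + 1) (β (α m)) - χ e α n (α (e m)) := by
  rw [μ_eq e α n (e m), h, map_add]
  abel

lemma exists_cover_comp_eq_μ (h : ∀ m, e (e m) = e m + β (α m)) (n : ℕ) :
    ∃ σ : M →ₗ[R] M × ((ℕ →₀ F) × (ℕ →₀ F)), ∀ m, cover e α β (σ m) = μ e α n m := by
  have hτ : ∀ n, ∃ τ : M →ₗ[R] M × ((ℕ →₀ F) × (ℕ →₀ F)),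
      ∀ m, cover e α β (τ m) = μ e α n (e m) := by
    intro n
    induction n with
    | zero => exact ⟨LinearMap.inl R _ _ ∘ₗ e, fun m => by simp [cover]⟩
    | succ n ih =>
      obtain ⟨τ, hτ⟩ := ih
      refine ⟨τ - ofRight (n + 1) ∘ₗ α - ofLeft n ∘ₗ α ∘ₗ e, fun m => ?_⟩
      rw [μ_succ_eq e α h, ← hτ]
      simp
  obtain ⟨τ, hτ⟩ := hτ (n + 1)
  refine ⟨τ + ofLeft n ∘ₗ α, fun m => ?_⟩
  rw [μ_eq, ← hτ]
  simp

/-- The section lifts `μ k` exactly for `k ≤ n`. Beyond `n` the telescope is collapsed onto stage `n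
+ 1` by using `e` in place of the later copies of `M`, and the defect `β ∘ α` is absorbed in the
value on the copies of `F`. -/
lemma exists_partial_section (h : ∀ m, e (e m) = e m + β (α m)) (n : ℕ) :
    ∃ s : Telescope e α →ₗ[R] M × ((ℕ →₀ F) × (ℕ →₀ F)),
      (∀ x ∈ stage e α n, cover e α β (s x) = x) ∧
      ∀ x, cover e α β (s x) ∈ stage e α (n + 1) := by
  obtain ⟨σ, hσ⟩ := exists_cover_comp_eq_μ e α β h (n + 1)
  let c : ℕ → F →ₗ[R] M × ((ℕ →₀ F) × (ℕ →₀ F)) := ofLeft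
  have hc : ∀ k x, cover e α β (c k x) = χ e α k x := cover_ofLeft e α β
  -- Backward recursion: `A j` lifts `μ (n - j)`. Only `j ≤ n` matters, so truncated subtraction is
  -- harmless.
  let A : ℕ → M →ₗ[R] M × ((ℕ →₀ F) × (ℕ →₀ F)) := fun j =>
    Nat.rec (σ ∘ₗ e + c n ∘ₗ α) (fun j A => A ∘ₗ e + c (n - (j + 1)) ∘ₗ α) j
  have hA0 : ∀ m, A 0 m = σ (e m) + c n (α m) := fun m => rfl
  have hA : ∀ j m, A (j + 1) m = A j (e m) + c (n - (j + 1)) (α m) := fun j m => rfl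
  have hAμ : ∀ j ≤ n, ∀ m, cover e α β (A j m) = μ e α (n - j) m := by
    intro j hj
    induction j with
    | zero => intro m; rw [hA0, map_add, hσ, hc, Nat.sub_zero, ← μ_eq]
    | succ j ih =>
      intro m
      rw [hA, map_add, ih (by omega), hc, μ_eq e α (n - (j + 1)),
        show n - (j + 1) + 1 = n - j by omega]
  let a : ℕ → M →ₗ[R] M × ((ℕ →₀ F) × (ℕ →₀ F)) := fun k =>
    if k ≤ n then A (n - k) else σ ∘ₗ e
  let b : ℕ → F →ₗ[R] M × ((ℕ →₀ F) × (ℕ →₀ F)) := fun k =>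
    if k < n then c k else if k = n then c n - σ ∘ₗ β else -(σ ∘ₗ β)
  have hab : ∀ k m, a k m = a (k + 1) (e m) + b k (α m) := by
    intro k m
    rcases lt_trichotomy k n with hk | rfl | hk
    · simp only [a, b, if_pos hk, if_pos hk.le, if_pos (Nat.succ_le_of_lt hk)]
      obtain ⟨j, rfl⟩ := Nat.exists_eq_add_of_lt hk
      rw [show k + j + 1 - k = j + 1 by omega, show k + j + 1 - (k + 1) = j by omega, hA,
        show k + j + 1 - (j + 1) = k by omega]
    · simp only [a, b, lt_irrefl, if_false, if_true, le_refl, Nat.sub_self, hA0,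
        Nat.succ_le_iff, LinearMap.comp_apply, LinearMap.sub_apply, h, map_add]
      abel
    · simp only [a, b, if_neg hk.not_ge, if_neg hk.not_gt, if_neg hk.ne',
        if_neg (show ¬ k + 1 ≤ n by omega), LinearMap.comp_apply, LinearMap.neg_apply, h, map_add]
      abel
  have hid : ∀ x ∈ stage e α n, cover e α β (desc e α a b hab x) = x := by
    have : stage e α n ≤ LinearMap.eqLocus (cover e α β ∘ₗ desc e α a b hab) LinearMap.id := by
      refine stage_le_iff.2 ⟨fun m => ?_, fun i hi x => ?_⟩
      · simp only [LinearMap.mem_eqLocus, LinearMap.comp_apply, desc_μ, LinearMap.id_apply]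
        simp only [a, if_pos le_rfl]
        rw [hAμ _ (by omega), Nat.sub_self, Nat.sub_zero]
      · simp only [LinearMap.mem_eqLocus, LinearMap.comp_apply, desc_χ, LinearMap.id_apply]
        simp only [b, if_pos hi, hc]
    exact this
  refine ⟨desc e α a b hab, hid, fun x => ?_⟩
  refine eq_top_of_mem (E := (stage e α (n + 1)).comap (cover e α β ∘ₗ desc e α a b hab))
    (fun k m => ?_) (fun k x => ?_) x
  · rw [mem_comap, LinearMap.comp_apply, desc_μ]
    by_cases hk : k ≤ n
    · simp only [a, if_pos hk]
      rw [hAμ _ (Nat.sub_le n k), Nat.sub_sub_self hk]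
      exact stage_mono e α (hk.trans (Nat.le_succ n)) (μ_mem_stage e α k m)
    · simp only [a, if_neg hk, LinearMap.comp_apply, hσ]
      exact μ_mem_stage e α _ _
  · rw [mem_comap, LinearMap.comp_apply, desc_χ]
    have h1 : ∀ y, μ e α (n + 1) y ∈ stage e α (n + 1) := μ_mem_stage e α (n + 1)
    rcases lt_trichotomy k n with hk | rfl | hk
    · simp only [b, if_pos hk, hc]
      exact χ_mem_stage e α (hk.trans (Nat.lt_succ_self n)) x
    · simp only [b, lt_irrefl, if_false, if_true, LinearMap.sub_apply, LinearMap.comp_apply,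
        map_sub, hc, hσ]
      exact sub_mem (χ_mem_stage e α (Nat.lt_succ_self k) x) (h1 _)
    · simp only [b, if_neg hk.not_gt, if_neg hk.ne', LinearMap.neg_apply, LinearMap.comp_apply,
        map_neg, hσ]
      exact neg_mem (h1 _)

/-- An endomorphism `e` of `M` idempotent up to a map factoring through `F` splits in
`M × F^(ω)`. -/
theorem exists_section_cover (h : ∀ m, e (e m) = e m + β (α m)) :
    ∃ S : Telescope e α →ₗ[R] M × ((ℕ →₀ F) × (ℕ →₀ F)), cover e α β ∘ₗ S = LinearMap.id :=
  (cover e α β).exists_rightInverse_of_exhaustion (stage e α) (stage_mono e α)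
    (exists_mem_stage e α) (exists_partial_section e α β h)

/-- At stage `0` this factors `e` through the telescope, so a projective telescope forces `e` to
vanish modulo `𝔪`. -/
lemma exists_proj (h : ∀ m, e (e m) = e m + β (α m)) :
    ∃ π : Telescope e α →ₗ[R] M, ∀ n m, π (μ e α n m) = e m :=
  ⟨desc e α (fun _ => e) (fun _ => -β) fun n m => by simp [h], fun n m => desc_μ _ n m⟩

/-- `μ 0` kills `1 - e` up to maps factoring through `α`, hence through `F`. -/
lemma μ_zero_sub (h : ∀ m, e (e m) = e m + β (α m)) (m : M) :
    μ e α 0 m - μ e α 0 (e m) =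
      χ e α 0 (α m) - χ e α 0 (α (e m)) - μ e α 1 (β (α m)) := by
  rw [μ_eq e α 0 m, μ_eq e α 0 (e m), h, map_add]
  abel

end Telescope

end Telescope

/-! ### Splitting off projective parts over a local ring. -/

section Decomposition

open Submodule IsLocalRing

variable {R : Type*} [CommRing R]

/-- If no linear form on `M` is surjective, a map through a projective module has image in
`𝔪 N`. -/
lemma LinearMap.range_comp_le_of_projective [IsLocalRing R] {M N Z : Type*} [AddCommGroup M]
    [Module R M] [AddCommGroup N] [Module R N] [AddCommGroup Z] [Module R Z]
    [Module.Projective R Z] (hM : ∀ φ : M →ₗ[R] R, ¬ Function.Surjective φ)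
    (g : M →ₗ[R] Z) (h : Z →ₗ[R] N) :
    LinearMap.range (h ∘ₗ g) ≤ maximalIdeal R • ⊤ := by
  obtain ⟨s, hs⟩ := (Module.projective_def' (R := R) (P := Z)).1 inferInstance
  rintro _ ⟨x, rfl⟩
  have h1 : g x = Finsupp.linearCombination R _root_.id (s (g x)) := congr($hs (g x)).symm
  rw [LinearMap.comp_apply, h1, Finsupp.linearCombination_apply, Finsupp.sum, map_sum]
  refine sum_mem fun z _ => ?_
  rw [map_smul]
  refine smul_mem_smul ?_ trivial
  by_contra hu
  have hu' : IsUnit (s (g x) z) := by simpa using hu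
  obtain ⟨c, hc⟩ := hu'
  refine hM (Finsupp.lapply z ∘ₗ s ∘ₗ g) fun r => ⟨(r * ((c⁻¹ : Rˣ) : R)) • x, ?_⟩
  simp [← hc, mul_assoc]

lemma LinearMap.surjective_of_isUnit_apply [IsLocalRing R] {M : Type*} [AddCommGroup M]
    [Module R M] {φ : M →ₗ[R] R} {x : M} (hx : IsUnit (φ x)) : Function.Surjective φ := by
  obtain ⟨c, hc⟩ := hx
  refine fun r => ⟨(r * ((c⁻¹ : Rˣ) : R)) • x, ?_⟩
  simp [← hc, mul_assoc]

lemma Submodule.projective_sup {M : Type*} [AddCommGroup M] [Module R M] {A B : Submodule R M}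
    (h : Disjoint A B) [Module.Projective R A] [Module.Projective R B] :
    Module.Projective R ↥(A ⊔ B) := by
  let f : (A × B) →ₗ[R] ↥(A ⊔ B) := (inclusion le_sup_left).coprod (inclusion le_sup_right)
  refine Module.Projective.of_equiv (LinearEquiv.ofBijective f ⟨?_, ?_⟩)
  · rw [injective_iff_map_eq_zero]
    rintro ⟨a, b⟩ hab
    have h1 : (a : M) + b = 0 := congrArg Subtype.val hab
    have h2 : (a : M) = 0 := disjoint_def.1 h _ a.2 (by
      rw [eq_neg_of_add_eq_zero_left h1]; exact neg_mem b.2)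
    rw [h2, zero_add] at h1
    exact Prod.ext (Subtype.ext h2) (Subtype.ext h1)
  · rintro ⟨x, hx⟩
    obtain ⟨a, ha, b, hb, rfl⟩ := mem_sup.1 hx
    exact ⟨(⟨a, ha⟩, ⟨b, hb⟩), rfl⟩

/-- A finitely generated torsion-free module over a local domain is the direct sum of a projective
module and a module without surjective linear forms. -/
lemma Submodule.exists_sup_projective [IsDomain R] [IsLocalRing R] {X : Type*} [AddCommGroup X]
    [Module R X] [Module.IsTorsionFree R X] (Z : Submodule R X) (hZ : Z.FG) :
    ∃ Z₀ Z₁ : Submodule R X, Disjoint Z₀ Z₁ ∧ Z₀ ⊔ Z₁ = Z ∧ Module.Projective R Z₁ ∧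
      ∀ φ : Z₀ →ₗ[R] R, ¬ Function.Surjective φ := by
  induction hn : Module.finrank R Z using Nat.strong_induction_on generalizing Z with
  | _ n ih =>
  by_cases hφ : ∀ φ : Z →ₗ[R] R, ¬ Function.Surjective φ
  · exact ⟨Z, ⊥, disjoint_bot_right, sup_bot_eq _, inferInstance, hφ⟩
  push Not at hφ
  obtain ⟨φ, hφ⟩ := hφ
  obtain ⟨z, hz⟩ := hφ 1
  -- A preimage `z` of `1` splits off `Rz ≅ R`, which lowers the rank by one.
  let Z₁ : Submodule R X := (LinearMap.ker φ).map Z.subtype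
  let Z₂ : Submodule R X := span R {(z : X)}
  have hd : Disjoint Z₁ Z₂ := by
    rw [disjoint_def]
    rintro _ ⟨y, hy, rfl⟩ hy2
    obtain ⟨r, hr⟩ := mem_span_singleton.1 hy2
    have h1 : r • z = y := Subtype.ext hr
    have h2 : φ y = 0 := hy
    rw [← h1, map_smul, hz, smul_eq_mul, mul_one] at h2
    rw [← h1, h2, zero_smul, map_zero]
  have hs : Z₁ ⊔ Z₂ = Z := by
    apply le_antisymm
    · exact sup_le (map_subtype_le _ _) (by rw [span_singleton_le_iff_mem]; exact z.2)
    · intro x hx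
      refine mem_sup.2 ⟨_, ⟨⟨x, hx⟩ - φ ⟨x, hx⟩ • z, ?_, rfl⟩, φ ⟨x, hx⟩ • (z : X),
        smul_mem _ _ (mem_span_singleton_self _), by simp⟩
      simp [hz]
  have hf1 : Z₁.FG := FG.of_sup_of_disjoint (hs.symm ▸ hZ) hd
  have e2 : R ≃ₗ[R] Z₂ := LinearEquiv.toSpanNonzeroSingleton R X (z : X) (by
    intro h0
    have : z = 0 := Subtype.ext h0
    rw [this, map_zero] at hz
    exact zero_ne_one hz)
  have hP2 : Module.Projective R Z₂ := Module.Projective.of_equiv e2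
  have hr : Module.finrank R Z = Module.finrank R Z₁ + Module.finrank R Z₂ := by
    have : Module.Finite R Z := Module.Finite.of_fg hZ
    have : Module.Finite R Z₁ := Module.Finite.of_fg hf1
    have : Module.Finite R Z₂ := Module.Finite.equiv e2
    have h3 := Submodule.rank_sup_add_rank_inf_eq Z₁ Z₂
    rw [hd.eq_bot, rank_bot, add_zero, hs, ← Module.finrank_eq_rank, ← Module.finrank_eq_rank,
      ← Module.finrank_eq_rank] at h3
    exact_mod_cast h3
  have h2 : Module.finrank R Z₂ = 1 := by rw [← e2.finrank_eq, Module.finrank_self]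
  obtain ⟨A, B, hAB, hAB', hB, hA⟩ := ih _ (by omega) Z₁ hf1 rfl
  refine ⟨A, B ⊔ Z₂, ?_, by rw [← sup_assoc, hAB', hs], ?_, hA⟩
  · exact hAB.disjoint_sup_right_of_disjoint_sup_left (hAB' ▸ hd)
  · exact projective_sup (hd.mono_left (hAB' ▸ le_sup_right))

/-- If a summand of `M × G`, with `M` finitely generated and `G` projective, is a direct sum of
finitely generated modules, then it is a direct sum of a finitely generated module without
surjective linear forms and a projective module. -/
lemma IsDirectSumOfFG.exists_isCompl_projective [IsDomain R] [IsLocalRing R] {M G : Type*}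
    {X : Type w} [AddCommGroup M] [Module R M] [Module.Finite R M] [AddCommGroup G] [Module R G]
    [Module.Projective R G] [AddCommGroup X] [Module R X] [Module.IsTorsionFree R X]
    (hX : IsDirectSumOfFG R X) {i : X →ₗ[R] M × G} {p : M × G →ₗ[R] X}
    (hpi : p ∘ₗ i = LinearMap.id) :
    ∃ X₀ X₁ : Submodule R X, IsCompl X₀ X₁ ∧ X₀.FG ∧ Module.Projective R X₁ ∧
      ∀ φ : X₀ →ₗ[R] R, ¬ Function.Surjective φ := by
  obtain ⟨ι, _, A, hA, hfg⟩ := hX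
  rw [DirectSum.isInternal_submodule_iff_iSupIndep_and_iSup_eq_top] at hA
  obtain ⟨s, hs⟩ := ((Module.Finite.fg_top (R := R) (M := M)).map
    (p ∘ₗ LinearMap.inl R M G)).exists_finset_le_biSup (hA.2 ▸ le_top : _ ≤ ⨆ i, A i)
  set B : Submodule R X := ⨆ i ∈ s, A i with hB
  set C : Submodule R X := ⨆ i ∈ (s : Set ι)ᶜ, A i with hC
  have hBC : IsCompl B C := by
    refine ⟨?_, ?_⟩
    · exact hA.1.disjoint_biSup_biSup (s := (s : Set ι)) (t := (s : Set ι)ᶜ) disjoint_compl_right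
    · rw [codisjoint_iff, eq_top_iff, ← hA.2]
      refine iSup_le fun i => ?_
      by_cases hi : i ∈ s
      · exact le_sup_of_le_left (le_biSup A hi)
      · exact le_sup_of_le_right (le_biSup (s := (s : Set ι)ᶜ) A hi)
  have hBfg : B.FG := fg_biSup s A fun i _ => Module.Finite.iff_fg.1 (hfg i)
  -- The finite partial sum `B` contains the image of `M`, so modulo `B` the retraction onto `C`
  -- only uses `G`; thus `C` is a summand of `G`.
  have hCproj : Module.Projective R C := by
    refine Module.Projective.of_split (LinearMap.snd R M G ∘ₗ i ∘ₗ C.subtype)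
      (C.projectionOnto B hBC.symm ∘ₗ p ∘ₗ LinearMap.inr R M G) ?_
    ext x
    have h1 : p (0, (i x).2) = x - p ((i x).1, 0) := by
      rw [eq_sub_iff_add_eq, ← map_add]
      have : p (i x) = x := congr($hpi x)
      simpa using this
    have h2 : C.projectionOnto B hBC.symm (p ((i x).1, 0)) = 0 :=
      (projectionOnto_apply_eq_zero_iff hBC.symm).2 (hs ⟨(i x).1, trivial, rfl⟩)
    simp [h1, h2]
  obtain ⟨Z₀, Z₁, hd, hsup, hP, hZ⟩ := B.exists_sup_projective hBfg
  have hd' : Disjoint Z₁ C := hBC.disjoint.mono_left (hsup ▸ le_sup_right)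
  refine ⟨Z₀, Z₁ ⊔ C, ⟨?_, ?_⟩, (hsup.symm ▸ hBfg : (Z₀ ⊔ Z₁).FG).of_sup_of_disjoint hd,
    projective_sup hd', hZ⟩
  · exact hd.disjoint_sup_right_of_disjoint_sup_left (hsup.symm ▸ hBC.disjoint)
  · rw [codisjoint_iff, ← sup_assoc, hsup, hBC.sup_eq_top]

lemma isCompl_sup_sup {α : Type*} [Lattice α] [BoundedOrder α] [IsModularLattice α]
    {x₀ x₁ y₀ y₁ : α} (hx : Disjoint x₀ x₁) (hy : Disjoint y₀ y₁)
    (h : IsCompl (x₀ ⊔ x₁) (y₀ ⊔ y₁)) : IsCompl (x₀ ⊔ y₀) (x₁ ⊔ y₁) := by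
  refine ⟨?_, ?_⟩
  · have h1 : Disjoint (x₀ ⊔ y₀) y₁ :=
      hy.disjoint_sup_left_of_disjoint_sup_right (h.disjoint.mono_left le_sup_left)
    have h2 : Disjoint (y₀ ⊔ y₁ ⊔ x₀) x₁ :=
      hx.disjoint_sup_left_of_disjoint_sup_right h.disjoint.symm
    rw [sup_comm _ x₀, ← sup_assoc] at h2
    rw [sup_comm x₁]
    exact h1.disjoint_sup_right_of_disjoint_sup_left h2
  · rw [codisjoint_iff, sup_sup_sup_comm, h.sup_eq_top]

/-- In a decomposition of `M × G`, with `M` indecomposable and `G` projective over a local ring,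
into two summands of the form finitely generated without surjective linear forms plus projective,
one of the two finitely generated parts vanishes. -/
lemma eq_bot_or_eq_bot_of_isCompl [IsLocalRing R] {M G : Type*} [AddCommGroup M]
    [Module R M] [AddCommGroup G] [Module R G] [Module.Projective R G]
    (hM : IsIndecomposableModule R M) {X₀ X₁ Y₀ Y₁ : Submodule R (M × G)}
    (hX : Disjoint X₀ X₁) (hY : Disjoint Y₀ Y₁) (hXY : IsCompl (X₀ ⊔ X₁) (Y₀ ⊔ Y₁))
    (hX₀ : X₀.FG) (hY₀ : Y₀.FG) (hφX : ∀ φ : X₀ →ₗ[R] R, ¬ Function.Surjective φ)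
    (hφY : ∀ φ : Y₀ →ₗ[R] R, ¬ Function.Surjective φ) : X₀ = ⊥ ∨ Y₀ = ⊥ := by
  have hXd : Disjoint X₀ Y₀ := hXY.disjoint.mono le_sup_left le_sup_left
  have hZ : IsCompl (X₀ ⊔ Y₀) (X₁ ⊔ Y₁) := isCompl_sup_sup hX hY hXY
  set Z := X₀ ⊔ Y₀ with hZdef
  have hZfg : Module.Finite R Z := Module.Finite.of_fg (hX₀.sup hY₀)
  have hφZ : ∀ φ : Z →ₗ[R] R, ¬ Function.Surjective φ := by
    intro φ hφ
    obtain ⟨⟨z, hz⟩, hz1⟩ := hφ 1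
    obtain ⟨x, hx, y, hy, rfl⟩ := mem_sup.1 hz
    have h1 : φ (inclusion le_sup_left ⟨x, hx⟩) + φ (inclusion le_sup_right ⟨y, hy⟩) = 1 := by
      rw [← map_add, ← hz1]
      rfl
    rcases IsLocalRing.isUnit_or_isUnit_of_add_one h1 with hu | hu
    · exact hφX (φ ∘ₗ inclusion le_sup_left) (LinearMap.surjective_of_isUnit_apply hu)
    · exact hφY (φ ∘ₗ inclusion le_sup_right) (LinearMap.surjective_of_isUnit_apply hu)
  let q : M × G →ₗ[R] Z := Z.projectionOnto _ hZ
  let j : Z →ₗ[R] M := LinearMap.fst R M G ∘ₗ Z.subtype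
  let k : M →ₗ[R] Z := q ∘ₗ LinearMap.inl R M G
  -- The difference with the identity passes through `G`, so it is zero modulo `𝔪`. Therefore `Z` is
  -- isomorphic to a summand of `M`, and indecomposability applies to its two parts.
  have hu : IsUnit (k ∘ₗ j : Module.End R Z) := by
    refine Module.End.isUnit_of_range_sub_le ?_
    have : (1 : Module.End R Z) - k ∘ₗ j =
        (q ∘ₗ LinearMap.inr R M G) ∘ₗ (LinearMap.snd R M G ∘ₗ Z.subtype) := by
      refine LinearMap.ext fun z => ?_
      rw [LinearMap.sub_apply, sub_eq_iff_eq_add]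
      have h1 : q z = z := projectionOnto_apply_left hZ z
      simp only [k, j, LinearMap.comp_apply, ← map_add]
      simpa using h1.symm
    rw [this]
    exact LinearMap.range_comp_le_of_projective hφZ _ _
  have hb := (Module.End.isUnit_iff _).1 hu
  have hj : Function.Injective j := fun a b hab => hb.1 (by simp [hab])
  have hcompl : IsCompl (LinearMap.range j) (LinearMap.ker k) := by
    refine ⟨disjoint_def.2 ?_, codisjoint_iff.2 (eq_top_iff.2 fun m _ => ?_)⟩
    · rintro _ ⟨z, rfl⟩ hz
      have : z = 0 := hb.1 (by simpa using hz)
      rw [this, map_zero]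
    · obtain ⟨z, hz⟩ := hb.2 (k m)
      refine mem_sup.2 ⟨j z, ⟨z, rfl⟩, m - j z, ?_, by simp⟩
      rw [LinearMap.mem_ker, map_sub, sub_eq_zero]
      exact hz.symm
  let X' : Submodule R M := LinearMap.range (j ∘ₗ inclusion (le_sup_left : X₀ ≤ Z))
  let Y' : Submodule R M := LinearMap.range (j ∘ₗ inclusion (le_sup_right : Y₀ ≤ Z))
  have hsup : X' ⊔ Y' = LinearMap.range j := by
    apply le_antisymm
    · exact sup_le (LinearMap.range_comp_le_range _ _) (LinearMap.range_comp_le_range _ _)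
    · rintro _ ⟨⟨z, hz⟩, rfl⟩
      obtain ⟨x, hx, y, hy, rfl⟩ := mem_sup.1 hz
      exact mem_sup.2 ⟨_, ⟨⟨x, hx⟩, rfl⟩, _, ⟨⟨y, hy⟩, rfl⟩, (j.map_add _ _).symm⟩
  have hdis : Disjoint X' Y' := by
    rw [disjoint_def]
    rintro _ ⟨x, rfl⟩ ⟨y, hy⟩
    have h1 : inclusion (le_sup_right : Y₀ ≤ Z) y = inclusion le_sup_left x := hj hy
    have h2 : (y : M × G) = x := congrArg Subtype.val h1
    have h3 : (x : M × G) = 0 := disjoint_def.1 hXd _ x.2 (h2 ▸ y.2)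
    have h4 : x = 0 := Subtype.ext h3
    rw [h4, map_zero]
  have hfin : IsCompl X' (Y' ⊔ LinearMap.ker k) :=
    ⟨hdis.disjoint_sup_right_of_disjoint_sup_left (hsup.symm ▸ hcompl.disjoint),
      by rw [codisjoint_iff, ← sup_assoc, hsup, hcompl.sup_eq_top]⟩
  have hbot : ∀ {W : Submodule R (M × G)} (hW : W ≤ Z),
      LinearMap.range (j ∘ₗ inclusion hW) = ⊥ → W = ⊥ := by
    intro W hW h0
    rw [LinearMap.range_eq_bot] at h0
    rw [eq_bot_iff]
    intro x hx
    have h1 : j (inclusion hW ⟨x, hx⟩) = 0 := congr($h0 ⟨x, hx⟩)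
    have h2 : inclusion hW ⟨x, hx⟩ = 0 := hj (by rw [h1, map_zero])
    exact congrArg Subtype.val h2
  rcases hM.2 _ _ hfin with h | h
  · exact Or.inl (hbot _ h)
  · exact Or.inr (hbot _ (sup_eq_bot_iff.1 h).1)

end Decomposition

/-! ### From condition (ii) to local endomorphism rings, and the theorem. -/

section Main

open Submodule IsLocalRing

/-- A maximal independent subfamily of the generators spans `N`; each generator has a nonzero
multiple in it, and `r` is the product of the multipliers. -/
lemma Module.Finite.exists_free_submodule_smul_mem {R : Type*} [CommRing R] [IsDomain R]
    (M : Type*) [AddCommGroup M] [Module R M] [Module.Finite R M] :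
    ∃ (r : R) (N : Submodule R M), r ≠ 0 ∧ Module.Free R N ∧ Module.Finite R N ∧
      ∀ m : M, r • m ∈ N := by
  obtain ⟨n, g, hg⟩ := Module.Finite.exists_fin (R := R) (M := M)
  obtain ⟨I, hI, hmax⟩ := exists_maximal_linearIndepOn R g
  have ha : ∀ i, ∃ a : R, a ≠ 0 ∧ a • g i ∈ span R (g '' I) := by
    intro i
    by_cases hi : i ∈ I
    · exact ⟨1, one_ne_zero, by rw [one_smul]; exact subset_span ⟨i, hi, rfl⟩⟩
    · exact hmax i hi
  choose a ha0 ha using ha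
  have hspan : span R (g '' I) = span R (Set.range fun i : I => g i) := by
    rw [Set.image_eq_range]
  refine ⟨∏ i, a i, span R (g '' I), Finset.prod_ne_zero_iff.2 fun i _ => ha0 i, ?_, ?_, ?_⟩
  · rw [hspan]
    exact Module.Free.of_basis (Module.Basis.span hI)
  · exact Module.Finite.of_fg (fg_span (Set.toFinite _))
  · have : (⊤ : Submodule R M) ≤ (span R (g '' I)).comap (LinearMap.lsmul R M (∏ i, a i)) := by
      rw [← hg, span_le]
      rintro _ ⟨i, rfl⟩
      have h1 : (∏ i, a i) • g i ∈ span R (g '' I) := by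
        rw [← Finset.prod_erase_mul _ _ (Finset.mem_univ i), mul_smul]
        exact smul_mem _ _ (ha i)
      exact h1
    exact fun m => this trivial

/-- Being a retract, rather than isomorphic, also covers finite index sets. -/
lemma Module.Basis.isSummandOf_of_countable {R κ G : Type*} [CommRing R] [AddCommGroup G]
    [Module R G] [Countable κ] (b : Module.Basis κ R G) : IsSummandOf R G (ℕ →₀ R) := by
  obtain ⟨f, hf⟩ := exists_injective_nat κ
  refine isSummandOf_iff.2 ⟨Finsupp.lmapDomain R R f ∘ₗ b.repr.toLinearMap,
    b.repr.symm.toLinearMap ∘ₗ Finsupp.lcomapDomain f hf, ?_⟩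
  ext x
  have : Finsupp.comapDomain f (Finsupp.mapDomain f (b.repr x)) hf.injOn = b.repr x :=
    Finsupp.comapDomain_mapDomain f hf _
  simp [Finsupp.lcomapDomain, this]

lemma IsSummandOf.prod {R M M' N N' : Type*} [CommRing R] [AddCommGroup M] [Module R M]
    [AddCommGroup N] [Module R N] [AddCommGroup M'] [Module R M'] [AddCommGroup N'] [Module R N']
    (h : IsSummandOf R N M) (h' : IsSummandOf R N' M') : IsSummandOf R (N × N') (M × M') := by
  obtain ⟨i, p, h⟩ := isSummandOf_iff.1 h
  obtain ⟨i', p', h'⟩ := isSummandOf_iff.1 h'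
  refine isSummandOf_iff.2 ⟨i.prodMap i', p.prodMap p', ?_⟩
  rw [LinearMap.prodMap_comp, h, h', LinearMap.prodMap_id]

lemma LinearEquiv.isSummandOf {R M N : Type*} [CommRing R] [AddCommGroup M] [Module R M]
    [AddCommGroup N] [Module R N] (e : N ≃ₗ[R] M) : IsSummandOf R N M :=
  isSummandOf_iff.2 ⟨e, e.symm, by ext; simp⟩

/-- An indecomposable module with a surjective linear form is free of rank one. -/
lemma IsIndecomposableModule.exists_eq_smul_of_surjective {R M : Type*} [CommRing R]
    [Nontrivial R] [AddCommGroup M] [Module R M] (hM : IsIndecomposableModule R M)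
    {φ : M →ₗ[R] R} (hφ : Function.Surjective φ) (f : Module.End R M) :
    ∃ c : R, f = algebraMap R (Module.End R M) c := by
  obtain ⟨z, hz⟩ := hφ 1
  have hcompl : IsCompl (LinearMap.ker φ) (span R {z}) := by
    refine ⟨disjoint_def.2 fun x hx hx' => ?_, codisjoint_iff.2 (eq_top_iff.2 fun x _ => ?_)⟩
    · obtain ⟨r, rfl⟩ := mem_span_singleton.1 hx'
      rw [LinearMap.mem_ker, map_smul, hz, smul_eq_mul, mul_one] at hx
      rw [hx, zero_smul]
    · refine mem_sup.2 ⟨x - φ x • z, by simp [hz], φ x • z,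
        smul_mem _ _ (mem_span_singleton_self z), by simp⟩
  have hker : LinearMap.ker φ = ⊥ := by
    refine (hM.2 _ _ hcompl).resolve_right fun h => ?_
    rw [span_singleton_eq_bot] at h
    rw [h, map_zero] at hz
    exact zero_ne_one hz
  have hinj := LinearMap.ker_eq_bot.1 hker
  refine ⟨φ (f z), LinearMap.ext fun m => ?_⟩
  have hm : m = φ m • z := hinj (by simp [hz])
  have hfz : f z = φ (f z) • z := hinj (by simp [hz])
  rw [Module.algebraMap_end_apply]
  conv_lhs => rw [hm, map_smul, hfz, smul_comm, ← hm]

/-- A summand which is the sum of a trivial and a projective submodule is projective. -/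
lemma Module.Projective.of_isCompl_bot {R X : Type*} [CommRing R] [AddCommGroup X] [Module R X]
    {X₀ X₁ : Submodule R X} (h : IsCompl X₀ X₁) (h0 : X₀ = ⊥) (h1 : Module.Projective R X₁) :
    Module.Projective R X := by
  have : X₁ = ⊤ := by simpa [h0] using h.sup_eq_top
  subst this
  exact Module.Projective.of_equiv Submodule.topEquiv

lemma Submodule.not_surjective_map {R X P : Type*} [CommRing R] [AddCommGroup X] [Module R X]
    [AddCommGroup P] [Module R P] {f : X →ₗ[R] P} (hf : Function.Injective f)
    {X₀ : Submodule R X} (h : ∀ φ : X₀ →ₗ[R] R, ¬ Function.Surjective φ) :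
    ∀ φ : X₀.map f →ₗ[R] R, ¬ Function.Surjective φ := fun φ hφ =>
  h (φ ∘ₗ (X₀.equivMapOfInjective f hf).toLinearMap)
    (hφ.comp (X₀.equivMapOfInjective f hf).surjective)

theorem indecomposablesHaveLocalEnd_of_summandsOfFreePlusAreDirectSums {R : Type u} [CommRing R]
    [IsDomain R] [IsLocalRing R] (hdim : ringKrullDim R ≤ 1)
    (h : SummandsOfFreePlusAreDirectSums.{u, w} R) : IndecomposablesHaveLocalEnd.{u, w} R := by
  intro M _ _ hfin htf hind
  have hnt := hind.1
  refine IsLocalRing.of_isUnit_or_isUnit_one_sub_self fun f => ?_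
  by_contra! hf
  obtain ⟨hf, hf'⟩ := hf
  -- Otherwise every endomorphism is a scalar, and locality of `R` makes `f` or `1 - f` a unit.
  have hφ : ∀ φ : M →ₗ[R] R, ¬ Function.Surjective φ := by
    intro φ hφ
    obtain ⟨c, rfl⟩ := hind.exists_eq_smul_of_surjective hφ f
    rcases IsLocalRing.isUnit_or_isUnit_one_sub_self c with hc | hc
    · exact hf (hc.map _)
    · exact hf' (by simpa using hc.map (algebraMap R (Module.End R M)))
  obtain ⟨r, F, hr, hFfree, hFfin, hrF⟩ := Module.Finite.exists_free_submodule_smul_mem (R := R) M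
  obtain ⟨e, g, heg, he, he'⟩ := Module.End.exists_almost_idempotent hdim hf hf' hr
  let α : M →ₗ[R] F := (r • g).codRestrict F fun m => hrF (g m)
  have hαβ : ∀ m, e (e m) = e m + F.subtype (α m) := fun m => congr($heg m)
  obtain ⟨S, hS⟩ := Telescope.exists_section_cover e α F.subtype hαβ
  obtain ⟨π, hπ⟩ := Telescope.exists_proj e α F.subtype hαβ
  set Ψ := Telescope.cover e α F.subtype with hΨ
  have hΨS : ∀ x, Ψ (S x) = x := fun x => congr($hS x)
  have hSinj : Function.Injective S := LinearMap.injective_of_comp_eq_id _ _ hS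
  have hcompl : IsCompl (LinearMap.range S) (LinearMap.ker Ψ) := by
    refine ⟨disjoint_def.2 ?_, codisjoint_iff.2 (eq_top_iff.2 fun x _ => ?_)⟩
    · rintro _ ⟨x, rfl⟩ hx
      rw [LinearMap.mem_ker, hΨS] at hx
      rw [hx, map_zero]
    · exact mem_sup.2 ⟨S (Ψ x), ⟨_, rfl⟩, x - S (Ψ x), by simp [hΨS], by simp⟩
  have hG : IsSummandOf R (M × ((ℕ →₀ F) × (ℕ →₀ F))) ((ℕ →₀ R) × M) := by
    refine (LinearEquiv.prodComm R M _).isSummandOf.trans (IsSummandOf.prod ?_ ?_)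
    · have b := Finsupp.basis fun _ : ℕ => Module.finBasis R F
      exact (b.prod b).isSummandOf_of_countable
    · exact (LinearEquiv.refl R M).isSummandOf
  have htfF : Module.IsTorsionFree R (ℕ →₀ F) :=
    DFunLike.coe_injective.moduleIsTorsionFree (fun v : ℕ →₀ F => (v : ℕ → F)) fun _ _ => rfl
  have htfX : Module.IsTorsionFree R (Telescope e α) := hSinj.moduleIsTorsionFree S (by simp)
  have hX : IsDirectSumOfFG R (Telescope e α) :=
    h M _ hfin htf ((isSummandOf_iff.2 ⟨S, Ψ, hS⟩).trans hG)
  have hY : IsDirectSumOfFG R (LinearMap.ker Ψ) :=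
    h M _ hfin htf (IsSummandOf.trans ⟨_, ⟨_, hcompl.symm⟩, ⟨LinearEquiv.refl R _⟩⟩ hG)
  obtain ⟨X₀, X₁, hX01, hX₀, hX₁, hXφ⟩ := hX.exists_isCompl_projective hS
  obtain ⟨Y₀, Y₁, hY01, hY₀, hY₁, hYφ⟩ := hY.exists_isCompl_projective
    (i := (LinearMap.ker Ψ).subtype) (p := (LinearMap.ker Ψ).projectionOnto _ hcompl.symm)
    (by ext1 x; simp)
  have hYinj := (LinearMap.ker Ψ).injective_subtype
  have hXs : X₀.map S ⊔ X₁.map S = LinearMap.range S := by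
    rw [← Submodule.map_sup, hX01.sup_eq_top, Submodule.map_top]
  have hYs : Y₀.map (LinearMap.ker Ψ).subtype ⊔ Y₁.map (LinearMap.ker Ψ).subtype =
      LinearMap.ker Ψ := by
    rw [← Submodule.map_sup, hY01.sup_eq_top, Submodule.map_top, range_subtype]
  have hor := eq_bot_or_eq_bot_of_isCompl hind
    (Submodule.disjoint_map hSinj hX01.disjoint) (Submodule.disjoint_map hYinj hY01.disjoint)
    (by rw [hXs, hYs]; exact hcompl) (hX₀.map S) (hY₀.map _)
    (not_surjective_map hSinj hXφ) (not_surjective_map hYinj hYφ)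
  rcases hor with h0 | h0
  · have h0' : X₀ = ⊥ := map_injective_of_injective hSinj (by simpa using h0)
    have := Module.Projective.of_isCompl_bot hX01 h0' hX₁
    refine he ?_
    have h1 : e = π ∘ₗ Telescope.μ e α 0 := LinearMap.ext fun m => (hπ 0 m).symm
    rw [h1]
    exact LinearMap.range_comp_le_of_projective hφ _ _
  · have h0' : Y₀ = ⊥ := map_injective_of_injective hYinj (by simpa using h0)
    have := Module.Projective.of_isCompl_bot hY01 h0' hY₁
    refine he' ?_
    let c : Telescope e α →ₗ[R] M := LinearMap.fst R _ _ ∘ₗ S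
    -- The difference between the identity of `M` and its route through the telescope is the route
    -- through `ker Ψ`, now projective.
    have hc : ∀ m, m - c (Telescope.μ e α 0 m) ∈ maximalIdeal R • (⊤ : Submodule R M) := by
      intro m
      have h1 := LinearMap.range_comp_le_of_projective hφ
        ((LinearMap.ker Ψ).projectionOnto _ hcompl.symm ∘ₗ LinearMap.inl R M _)
        (LinearMap.fst R _ _ ∘ₗ (LinearMap.ker Ψ).subtype) ⟨m, rfl⟩
      have h2 : Telescope.μ e α 0 m = Ψ (m, 0) := by simp [hΨ, Telescope.cover]
      have h3 : (LinearMap.range S).projection _ hcompl (m, 0) = S (Ψ (m, 0)) := by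
        have h4 := (projection_apply_eq_zero_iff hcompl).2
          (show (m, 0) - S (Ψ (m, 0)) ∈ LinearMap.ker Ψ by simp [hΨS])
        rw [map_sub, sub_eq_zero] at h4
        exact h4.trans ((projection_eq_self_iff hcompl _).2 ⟨_, rfl⟩)
      have h4 : (((LinearMap.ker Ψ).projectionOnto _ hcompl.symm (m, 0) : LinearMap.ker Ψ) :
          M × ((ℕ →₀ F) × (ℕ →₀ F))) = (m, 0) - S (Ψ (m, 0)) := by
        rw [← h3, ← projection_eq_self_sub_projection hcompl]
        rfl
      have h5 := congrArg Prod.fst h4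
      rw [h2]
      exact Set.mem_of_eq_of_mem h5.symm h1
    have hα : ∀ (k : F →ₗ[R] M) m, k (α m) ∈ maximalIdeal R • (⊤ : Submodule R M) := fun k m =>
      LinearMap.range_comp_le_of_projective hφ α k ⟨m, rfl⟩
    rintro _ ⟨m, rfl⟩
    -- Modulo `𝔪M` the first two brackets vanish by `hc`, and the last term factors through the free
    -- module `F`.
    have h1 : (1 - e) m = (m - c (Telescope.μ e α 0 m)) - (e m - c (Telescope.μ e α 0 (e m))) +
        c (Telescope.μ e α 0 m - Telescope.μ e α 0 (e m)) := by
      rw [map_sub, LinearMap.sub_apply, Module.End.one_apply]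
      abel
    rw [h1, Telescope.μ_zero_sub e α F.subtype hαβ, map_sub, map_sub]
    refine add_mem (sub_mem (hc m) (hc (e m))) (sub_mem (sub_mem ?_ ?_) ?_)
    · exact hα (c ∘ₗ Telescope.χ e α 0) m
    · exact hα (c ∘ₗ Telescope.χ e α 0) (e m)
    · exact hα (c ∘ₗ Telescope.μ e α 1 ∘ₗ F.subtype) m

theorem mainTheorem1 (R : Type u) [CommRing R] [IsDomain R] [IsLocalRing R]
    (hdim : ringKrullDim R = 1) :
    List.TFAE
      [DirectSumsClosedUnderSummands.{u, max u w} R,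
       SummandsOfFreePlusAreDirectSums.{u, max u w} R,
       AddModulesAreDirectSums.{u, max u w} R,
       IndecomposablesHaveLocalEnd.{u, max u w} R] ∧
    (DirectSumsClosedUnderSummands.{u, max u w} R →
      ∀ (Q : Type u) [Field Q] [Algebra R Q] [IsFractionRing R Q] (S : Subalgebra R Q),
        S ≤ integralClosure R Q →
          DirectSumsClosedUnderSummands.{u, max u w} S ∧
          SummandsOfFreePlusAreDirectSums.{u, max u w} S ∧
          AddModulesAreDirectSums.{u, max u w} S ∧
          IndecomposablesHaveLocalEnd.{u, max u w} S) := by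
  have htfae : List.TFAE
      [DirectSumsClosedUnderSummands.{u, max u w} R,
       SummandsOfFreePlusAreDirectSums.{u, max u w} R,
       AddModulesAreDirectSums.{u, max u w} R,
       IndecomposablesHaveLocalEnd.{u, max u w} R] := by
    tfae_have 1 → 3 := addModulesAreDirectSums_of_directSumsClosedUnderSummands
    tfae_have 3 → 2 := summandsOfFreePlusAreDirectSums_of_addModulesAreDirectSums.{u, w}
    tfae_have 2 → 4 := indecomposablesHaveLocalEnd_of_summandsOfFreePlusAreDirectSums hdim.le
    tfae_have 4 → 1 := directSumsClosedUnderSummands_of_indecomposablesHaveLocalEnd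
    tfae_finish
  refine ⟨htfae, fun h Q _ _ _ S hS => ?_⟩
  have h4R : IndecomposablesHaveLocalEnd.{u, max u w} R := (htfae.out 0 3).1 h
  have h4 := h4R.subalgebra S hS
  have h1 := directSumsClosedUnderSummands_of_indecomposablesHaveLocalEnd h4
  have h3 := addModulesAreDirectSums_of_directSumsClosedUnderSummands h1
  exact ⟨h1, summandsOfFreePlusAreDirectSums_of_addModulesAreDirectSums.{u, w} h3, h3, h4⟩

end Main
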